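/- **Setting.** For each $n$ let $d=d_n\ge 1$, $p=p_n\ge 1$, $s_b,s_x\in\mathbb N$ (all may depend on $n$), let $Z=[z_1,\dots,z_n]'\in\mathbb R^{n\times p}$ be fixed covariates, $x_1^*,\dots,x_n^*\in\mathbb R^d$ true latent positions, $B^*\in\mathbb R^{p\times d}$ with rows $b_1^*,\dots,b_p^*\in\mathbb R^d$, and $\beta^*=\beta^*_n\in\mathbb R$, such that $$\#\{i: x_i^*\ne B^{*\prime}z_i\}\le s_x,\qquad \#\{j: b_j^*\neq 0\}\le s_b .$$ The observed network is $\mathcal Y=(Y_{ij})_{1\le i\le j\le n}$ with independent $Y_{ij}\sim\mathrm{Bernoulli}\big(1/\{1+\exp(-\beta^*-x_i^{*\prime}x_j^*)\}\big)$. Fix $M_0>0$ and put $\epsilon_n=M_0\sqrt{(1+s_b+s_x)\,d\log(np)/n^2}$. **Prior.** $\tau_b,\tau_x,\lambda_{b_j},\lambda_{x_i}$ are independent standard half-Cauchy variables; given these, $b_j\sim\mathcal N(0,\lambda_{b_j}^2\tau_b^2 I_d)$ independently for $j\le p$, and, given $B=[b_1,\dots,b_p]'$, $x_i\sim\mathcal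 N(B'z_i,\lambda_{x_i}^2\tau_x^2I_d)$ independently for $i\le n$. The resulting law of $X=(x_1,\dots,x_n)$ is conditioned on the event $\{\|x_i\|_\infty\le C_5,\ \|x_i\|_2\le R_5\ \forall i,\ \|\sum_i x_i\|_\infty\le C_6\}$; $\beta$ is independent of $X$ with prior law $\Pi_\beta$ (which may depend on $n$). For $\alpha\in(0,1)$, $\Pi_\alpha(\cdot\mid\mathcal Y)$ denotes the fractional posterior of $(X,\beta)$, proportional to (likelihood)$^{\alpha}$ times this prior. **Assumptions.** $\epsilon_n\to0$ and $\log p=O(\log n)$. There are constants such that: 1. $\|x_i^*\|_\infty\le C_1$ and $\|x_i^*\|_2\le R_1$ for all $i$, and $\max_j\|b_j^*\|_\infty=O(p^{C_2})$; 2. for some $\bar c$ and some $c_0>0$ and all large $n$: $\|Z\tilde B\|_F^2\le\bar c\,n\|\tilde B\|_F^2$ for all $\tilde B\in\mathbb R^{p\times d}$ with $\sum_j\|\tilde b_j\|_2\le c_0\max(1,s_b)\,d\log(np)$, where $\tilde b_j$ are the rows of $\tilde B$; 3. $\epsilon_n^2=o(e^{\beta^*})$, and $\beta^*$ is bounded above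 in $n$; 4. for some $c_4,\kappa>0$ and all large $n$: $\Pi_\beta(|\beta-\beta^*|\le c_4\epsilon_n)\ge\kappa\,e^{-n^2\epsilon_n^2}$; 5. $\sum_i x_i^*=0$; 6. $C_5>C_1$, $R_5>R_1$, $C_6>0$. **Conclusion.** There is a constant $M_{\min}>0$ (not depending on $n$, $D$, $\eta$) such that for all $M\ge M_{\min}$, $D\ge2$ and $\eta>0$, for all large enough $n$, with probability at least $1-2/\{(D-1+\eta)^2n^2\epsilon_n^2\}$ over the data $\mathcal Y$, $$\Pi_\alpha\Big\{\frac1{n^2}\sum_{i,j=1}^n(x_i'x_j-x_i^{*\prime}x_j^*)^2+(\beta-\beta^*)^2\ \ge\ M\,\frac{D+3\eta}{1-\alpha}\,e^{-\beta^*}\epsilon_n^2\ \Big|\ \mathcal Y\Big\}\le e^{-\eta n^2\epsilon_n^2}.$$ -/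

import Mathlib

open MeasureTheory ProbabilityTheory Filter Topology

/-- An array of `n` vectors in `ℝ^d`; the `i`-th row is `x i`. -/
abbrev Rows (n d : ℕ) : Type := Fin n → Fin d → ℝ

/-- Index set of the observed dyads `i ≤ j` (diagonal included). -/
abbrev Dyad (n : ℕ) : Type := {e : Fin n × Fin n // e.1 ≤ e.2}

/-- An undirected binary network on `n` nodes, diagonal entries included. -/
abbrev Network (n : ℕ) : Type := Dyad n → Bool

/-- The log-odds `β + x_i' x_j` of an edge. -/
def logOdds {n d : ℕ} (x : Rows n d) (β : ℝ) (e : Dyad n) : ℝ :=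
  β + x e.1.1 ⬝ᵥ x e.1.2

/-- The law of the network under `(x, β)`: independent `Y_ij`, `i ≤ j`, with
`Y_ij ~ Bernoulli (1 / (1 + exp (-β - x_i' x_j)))`. -/
noncomputable def networkLaw {n d : ℕ} (x : Rows n d) (β : ℝ) : Measure (Network n) :=
  Measure.pi fun e => bernoulliMeasure true false (unitInterval.sigmoid (logOdds x β e))

/-- The likelihood `P(Y | x, β)`. -/
noncomputable def likelihood {n d : ℕ} (Y : Network n) (x : Rows n d) (β : ℝ) : ℝ :=
  ∏ e : Dyad n, if Y e then Real.sigmoid (logOdds x β e) else 1 - Real.sigmoid (logOdds x β e)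

/-- The half-Cauchy distribution `Ca⁺(0, 1)`: the law of `|T|` for a standard Cauchy `T`. -/
noncomputable def halfCauchy : Measure ℝ := (cauchyMeasure 0 1).map fun t => |t|

instance : IsProbabilityMeasure halfCauchy :=
  Measure.isProbabilityMeasure_map (by fun_prop)

/-- The global-local shrinkage (horseshoe) law of `m` vectors in `ℝ^d`:
`v_j | λ_j, τ ~ N(0, λ_j² τ² I_d)` independently over `j`, with independent `τ ~ Ca⁺(0, 1)` and
`λ_j ~ Ca⁺(0, 1)`; realised as `v_j = λ_j τ g_j` with independent standard Gaussian `g_j`. -/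
noncomputable def horseshoe (m d : ℕ) : Measure (Rows m d) :=
  (halfCauchy.prod
    ((Measure.pi fun _ : Fin m => halfCauchy).prod
      (Measure.pi fun _ : Fin m => Measure.pi fun _ : Fin d => gaussianReal 0 1))).map
    fun w j k => w.2.1 j * w.1 * w.2.2 j k

/-- The row array `Z B`, whose `i`-th row is `B' z_i`. -/
def covariateMap {n p d : ℕ} (Z : Rows n p) (B : Rows p d) : Rows n d :=
  fun i k => ∑ j, Z i j * B j k

/-- The hierarchical prior on the latent positions, with `B` and all scales integrated out:
`B` is horseshoe distributed and, given `B`, `x_i ~ N(B' z_i, λ_i² τ² I_d)` with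
independent half-Cauchy scales. -/
noncomputable def latentPrior {n p : ℕ} (d : ℕ) (Z : Rows n p) : Measure (Rows n d) :=
  ((horseshoe p d).prod (horseshoe n d)).map fun w => covariateMap Z w.1 + w.2

/-- Bounded and roughly centred latent positions: `‖x_i‖_∞ ≤ C` and `‖x_i‖_2 ≤ R` for all `i`, and
`‖∑ x_i‖_∞ ≤ C'`. -/
def boundedRegion (n d : ℕ) (C R C' : ℝ) : Set (Rows n d) :=
  {x | (∀ i k, |x i k| ≤ C) ∧ (∀ i, √(∑ k, x i k ^ 2) ≤ R) ∧ ∀ k, |∑ i, x i k| ≤ C'}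

/-- The joint prior on `(x, β)`: independent, with the latent prior conditioned on a set `S`. -/
noncomputable def restrictedPrior {n p d : ℕ} (Z : Rows n p) (S : Set (Rows n d))
    (priorβ : Measure ℝ) : Measure (Rows n d × ℝ) :=
  (cond (latentPrior d Z) S).prod priorβ

/-- The fractional posterior `∝ P(Y | x, β)^α · prior`. -/
noncomputable def fractionalPosterior {n d : ℕ} (prior : Measure (Rows n d × ℝ)) (α : ℝ)
    (Y : Network n) : Measure (Rows n d × ℝ) :=
  (∫⁻ θ, ENNReal.ofReal (likelihood Y θ.1 θ.2 ^ α) ∂prior)⁻¹ •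
    prior.withDensity fun θ => ENNReal.ofReal (likelihood Y θ.1 θ.2 ^ α)

/-- The rate `ε_n = M₀ √((1 + s_b + s_x) d log (n p) / n²)`. -/
noncomputable def epsRate (M₀ : ℝ) (n p d sb sx : ℕ) : ℝ :=
  M₀ * √((1 + sb + sx) * d * Real.log (n * p) / (n : ℝ) ^ 2)

/-- The loss `n⁻² ∑_{i,j} (x_i' x_j - x⋆_i' x⋆_j)² + (β - β⋆)²`. -/
noncomputable def recoveryLoss {n d : ℕ} (x xs : Rows n d) (β βs : ℝ) : ℝ :=
  1 / (n : ℝ) ^ 2 * ∑ i, ∑ j, (x i ⬝ᵥ x j - xs i ⬝ᵥ xs j) ^ 2 + (β - βs) ^ 2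

/-- The squared Frobenius norm. -/
def frobSq {m d : ℕ} (A : Rows m d) : ℝ := ∑ j, ∑ k, A j k ^ 2

/-- The group norm `‖B‖_{2,1} = ∑_j ‖b_j‖_2` over the rows `b_j ∈ ℝ^d`. -/
noncomputable def groupNorm {m d : ℕ} (B : Rows m d) : ℝ := ∑ j, √(∑ k, B j k ^ 2)

/-! ### Scalar inequalities for Bernoulli laws with logistic parameters -/

/-! Write `L` for the likelihood, `L*` for its value at the truth and `E = n² ε²`. The posterior
mass of a set `U` is the ratio of `∫_U (L/L*)^α` to `∫ (L/L*)^α` under the prior, and the two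
integrals are controlled separately.

Numerator: its mean is an integral of affinities `∑ L^α L*^(1-α)`, which factor over dyads. A
Hellinger bound makes each factor at most `exp(-C e^b min(1, (a-b)²))`, with `a`, `b` the log-odds
at the parameter and at the truth. The weight `e^b` is of order `e^β*`, which cancels the `e^(-β*)`
in the loss threshold. As the truth is centred and the prior nearly so, `∑ (x_i'x_j - x_i*'x_j*)` is
small. Hence `β` and the Gram matrix cannot compensate each other, and the truncated log-odds
distance dominates the loss (`sum_min_sq_ge`). On `U` the affinity is therefore at most `exp(-c M q
E)`.

Denominator: on a small neighbourhood `V` of the truth the second moment of `L*/L` is at most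
`e^(b'E)`. Markov's inequality and `1 ≤ c x^(-α) + x/c` turn this into a lower bound on `∫ (L/L*)^α`
in terms of the prior mass of `V`. That mass is at least `e^(-m'E)`: the horseshoe pays a power of
`1/N` only for active rows (`horseshoe_small_ball`), with `N` a power of `np`, and the exponent
times `log(np)` is of order `E`.

`fractionalPosterior_le_with_high_probability` combines both halves at confidence `1 - 2/k`. Taking
`k = e^E` costs only another multiple of `E` in the exponent, so a large `M` absorbs everything. -/

lemma one_sub_sigmoid (a : ℝ) : 1 - Real.sigmoid a = (1 + Real.exp a)⁻¹ := by
  rw [← Real.sigmoid_neg, Real.sigmoid_def, neg_neg]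

lemma sigmoid_eq_exp_div (a : ℝ) : Real.sigmoid a = Real.exp a / (1 + Real.exp a) := by
  rw [Real.sigmoid_def, Real.exp_neg]
  have := Real.exp_pos a
  field_simp
  ring

/-- The second moment of the likelihood ratio of two logistic Bernoulli laws. -/
lemma sq_div_sigmoid_add_le (a b : ℝ) :
    Real.sigmoid b ^ 2 / Real.sigmoid a + (1 - Real.sigmoid b) ^ 2 / (1 - Real.sigmoid a) ≤
      Real.exp ((a - b) ^ 2 / 2) := by
  refine le_trans ?_ (Real.cosh_le_exp_half_sq (a - b))
  rw [one_sub_sigmoid, one_sub_sigmoid, sigmoid_eq_exp_div, sigmoid_eq_exp_div, Real.cosh_eq,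
    Real.exp_neg]
  have ha : Real.exp a = Real.exp b * Real.exp (a - b) := by rw [← Real.exp_add]; congr 1; ring
  rw [ha]
  have hs := Real.exp_pos b
  have he := Real.exp_pos (a - b)
  set s := Real.exp b
  set e := Real.exp (a - b)
  -- The second moment falls short of `cosh (a - b)` by an explicit nonnegative remainder.
  have key : (s / (1 + s)) ^ 2 / (s * e / (1 + s * e)) + (1 + s)⁻¹ ^ 2 / (1 + s * e)⁻¹ =
      (e + e⁻¹) / 2 - (e - 1) ^ 2 * (1 + s ^ 2) / (2 * e * (1 + s) ^ 2) := by
    field_simp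
    ring
  rw [key]
  have : 0 ≤ (e - 1) ^ 2 * (1 + s ^ 2) / (2 * e * (1 + s) ^ 2) := by positivity
  linarith

/-- Comparison of the `α`-affinity of two Bernoulli laws with their Bhattacharyya coefficient. -/
lemma affinity_le_of_bhattacharyya {α p q : ℝ} (hα₀ : 0 < α) (hα₁ : α < 1) (hp₀ : 0 < p)
    (hp₁ : p < 1) (hq₀ : 0 < q) (hq₁ : q < 1) :
    q ^ α * p ^ (1 - α) + (1 - q) ^ α * (1 - p) ^ (1 - α) ≤
      1 - 2 * min α (1 - α) * (1 - (√(q * p) + √((1 - q) * (1 - p)))) := by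
  -- Weighted AM-GM on `x^α y^(1-α) = (√(xy))^(2α) y^(1-2α)`. Summed over the two outcomes, the `y`
  -- terms add up to one. For `α ≥ 1/2` the roles of `x` and `y` are exchanged.
  have left : ∀ {x y : ℝ}, 0 < x → 0 < y → α ≤ 1 / 2 →
      x ^ α * y ^ (1 - α) ≤ 2 * α * √(x * y) + (1 - 2 * α) * y := by
    intro x y hx hy h
    have := Real.geom_mean_le_arith_mean2_weighted (w₁ := 2 * α) (w₂ := 1 - 2 * α)
      (p₁ := √(x * y)) (p₂ := y) (by linarith) (by linarith) (by positivity) hy.le (by ring)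
    refine le_trans (le_of_eq ?_) this
    rw [Real.sqrt_eq_rpow, ← Real.rpow_mul (by positivity), Real.mul_rpow hx.le hy.le, mul_assoc,
      ← Real.rpow_add hy]
    ring_nf
  have right : ∀ {x y : ℝ}, 0 < x → 0 < y → 1 / 2 ≤ α →
      x ^ α * y ^ (1 - α) ≤ 2 * (1 - α) * √(x * y) + (1 - 2 * (1 - α)) * x := by
    intro x y hx hy h
    have := Real.geom_mean_le_arith_mean2_weighted (w₁ := 2 * (1 - α)) (w₂ := 1 - 2 * (1 - α))
      (p₁ := √(x * y)) (p₂ := x) (by linarith) (by linarith) (by positivity) hx.le (by ring)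
    refine le_trans (le_of_eq ?_) this
    rw [Real.sqrt_eq_rpow, ← Real.rpow_mul (by positivity), Real.mul_rpow hx.le hy.le,
      mul_right_comm, ← Real.rpow_add hx]
    ring_nf
  have hp' : 0 < 1 - p := by linarith
  have hq' : 0 < 1 - q := by linarith
  rcases le_total α (1 / 2) with h | h
  · rw [min_eq_left (by linarith)]
    linarith [left hq₀ hp₀ h, left hq' hp' h]
  · rw [min_eq_right (by linarith)]
    linarith [right hq₀ hp₀ h, right hq' hp' h]

lemma min_one_abs_div_three_le (t : ℝ) : min 1 |t| / 3 ≤ 1 - Real.exp (-(|t| / 2)) := by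
  have h0 := abs_nonneg t
  have h1 : Real.exp (-(|t| / 2)) ≤ 1 / (1 + |t| / 2) := by
    rw [Real.exp_neg, one_div]
    exact inv_anti₀ (by positivity) (by linarith [Real.add_one_le_exp (|t| / 2)])
  have h2 : min 1 |t| / 3 ≤ 1 - 1 / (1 + |t| / 2) := by
    rw [show 1 - 1 / (1 + |t| / 2) = |t| / (2 + |t|) by field_simp; ring, div_le_div_iff₀ (by norm_num)
      (by positivity)]
    rcases le_total 1 |t| with h | h
    · rw [min_eq_left h]; linarith
    · rw [min_eq_right h]; nlinarith
  linarith

/-- Lower bound on the squared Hellinger distance of two logistic Bernoulli laws. -/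
lemma one_sub_bhattacharyya_ge {a b B : ℝ} (hb : b ≤ B) :
    Real.exp b * min 1 ((a - b) ^ 2) / (18 * (1 + Real.exp B) ^ 2) ≤
      1 - (√(Real.sigmoid a * Real.sigmoid b) +
        √((1 - Real.sigmoid a) * (1 - Real.sigmoid b))) := by
  set t := a - b with ht
  have ha : a = b + t := by rw [ht]; ring
  have hs := Real.exp_pos b
  have hsB : Real.exp b ≤ Real.exp B := Real.exp_le_exp.2 hb
  have hr : Real.exp a = Real.exp b * Real.exp (t / 2) ^ 2 := by
    rw [ha, Real.exp_add, ← Real.exp_nat_mul]; congr 2; push_cast; ring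
  have hrp := Real.exp_pos (t / 2)
  have hmin : min 1 (t ^ 2) = (min 1 |t|) ^ 2 := by
    rcases le_total 1 |t| with h | h
    · rw [min_eq_left h, min_eq_left (by rw [← sq_abs]; nlinarith)]; norm_num
    · rw [min_eq_right h, min_eq_right (by rw [← sq_abs]; nlinarith [abs_nonneg t]), sq_abs]
  have hm := min_one_abs_div_three_le t
  have hm0 : 0 ≤ min 1 |t| := le_min zero_le_one (abs_nonneg t)
  rw [hmin, one_sub_sigmoid, one_sub_sigmoid, sigmoid_eq_exp_div, sigmoid_eq_exp_div, hr]
  set s := Real.exp b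
  set r := Real.exp (t / 2)
  set m := min 1 |t|
  set U := Real.exp B
  have e1 : s * r ^ 2 / (1 + s * r ^ 2) * (s / (1 + s)) =
      (s * r) ^ 2 * ((1 + s * r ^ 2) * (1 + s))⁻¹ := by field_simp
  have e2 : (1 + s * r ^ 2)⁻¹ * (1 + s)⁻¹ = ((1 + s * r ^ 2) * (1 + s))⁻¹ := by
    rw [mul_inv]
  rw [e1, e2, Real.sqrt_mul (by positivity), Real.sqrt_sq (by positivity)]
  set W := (1 + s * r ^ 2) * (1 + s) with hW
  have hWp : 0 < W := by positivity
  set v := √W⁻¹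
  have hv0 : 0 ≤ v := Real.sqrt_nonneg _
  have hv : v ^ 2 = W⁻¹ := Real.sq_sqrt (by positivity)
  -- The Bhattacharyya coefficient is `(s r + 1)/√W`, and `W - (s r + 1)² = s (r - 1)²`.
  have hx : (s * r * v + v) ^ 2 = 1 - s * (r - 1) ^ 2 / W := by
    have : (s * r * v + v) ^ 2 = (s * r + 1) ^ 2 * v ^ 2 := by ring
    rw [this, hv]
    field_simp
    rw [hW]; ring
  have hlow : s * m ^ 2 / (9 * (1 + U) ^ 2) ≤ s * (r - 1) ^ 2 / W := by
    rw [div_le_div_iff₀ (by positivity) hWp]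
    have : m ^ 2 * W ≤ 9 * (1 + U) ^ 2 * (r - 1) ^ 2 := by
      have h1s : 1 + s ≤ 1 + U := by linarith
      -- For `t ≥ 0` the factor `W` may grow like `r²`, which is absorbed by keeping the `r` in `m r
      -- ≤ 3 (r - 1)`. For `t ≤ 0` the factor `W` is bounded.
      rcases le_total 0 t with h | h
      · have hr1 : 1 ≤ r := Real.one_le_exp (by positivity)
        have hmr : m * r ≤ 3 * (r - 1) := by
          rw [abs_of_nonneg h, Real.exp_neg] at hm
          have : m / 3 * r ≤ (1 - r⁻¹) * r := mul_le_mul_of_nonneg_right hm hrp.le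
          rw [sub_mul, inv_mul_cancel₀ hrp.ne'] at this
          linarith
        have hmr2 : (m * r) ^ 2 ≤ (3 * (r - 1)) ^ 2 := pow_le_pow_left₀ (by positivity) hmr 2
        have hW2 : W ≤ (1 + U) ^ 2 * r ^ 2 := by
          have : 1 + s * r ^ 2 ≤ (1 + U) * r ^ 2 := by nlinarith [sq_nonneg r]
          calc W ≤ (1 + U) * r ^ 2 * (1 + U) := by
                rw [hW]; exact mul_le_mul this h1s (by positivity) (by positivity)
            _ = _ := by ring
        calc m ^ 2 * W ≤ m ^ 2 * ((1 + U) ^ 2 * r ^ 2) := by gcongr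
          _ = (1 + U) ^ 2 * (m * r) ^ 2 := by ring
          _ ≤ (1 + U) ^ 2 * (3 * (r - 1)) ^ 2 := by gcongr
          _ = _ := by ring
      · have hr1 : r ≤ 1 := Real.exp_le_one_iff.2 (by linarith)
        have hmr : m ≤ 3 * (1 - r) := by
          rw [abs_of_nonpos h, show -(-t / 2) = t / 2 by ring] at hm
          linarith
        have hmr2 : m ^ 2 ≤ (3 * (1 - r)) ^ 2 := pow_le_pow_left₀ hm0 hmr 2
        have hW2 : W ≤ (1 + U) ^ 2 := by
          have : 1 + s * r ^ 2 ≤ 1 + U := by nlinarith [pow_le_one₀ hrp.le hr1 (n := 2)]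
          calc W ≤ (1 + U) * (1 + U) := by
                rw [hW]; exact mul_le_mul this h1s (by positivity) (by positivity)
            _ = _ := by ring
        calc m ^ 2 * W ≤ (3 * (1 - r)) ^ 2 * (1 + U) ^ 2 := by gcongr
          _ = _ := by ring
    nlinarith
  have hfin : s * m ^ 2 / (18 * (1 + U) ^ 2) = s * m ^ 2 / (9 * (1 + U) ^ 2) / 2 := by
    rw [div_div]; congr 1; ring
  rw [hfin]
  -- For the coefficient `x`, `(x - 1)² ≥ 0` gives `1 - x ≥ (1 - x²)/2`; this doubles the 9 to 18.
  have hy := sq_nonneg (s * r * v + v - 1)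
  rw [sub_sq, hx] at hy
  linarith

/-- The constant in the lower bound on the Rényi divergence of logistic Bernoulli laws. -/
noncomputable def renyiConst (α B : ℝ) : ℝ := min α (1 - α) / (9 * (1 + Real.exp B) ^ 2)

lemma renyiConst_pos {α : ℝ} (B : ℝ) (hα₀ : 0 < α) (hα₁ : α < 1) : 0 < renyiConst α B :=
  div_pos (lt_min hα₀ (by linarith)) (by positivity)

/-- The form `1 - u ≤ e^(-u)` makes the bounds multiply over dyads. Keeping the odds `e^b` explicit
makes the bound sharp enough for sparse networks. -/
lemma affinity_sigmoid_le {α a b B : ℝ} (hα₀ : 0 < α) (hα₁ : α < 1) (hb : b ≤ B) :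
    Real.sigmoid a ^ α * Real.sigmoid b ^ (1 - α) +
        (1 - Real.sigmoid a) ^ α * (1 - Real.sigmoid b) ^ (1 - α) ≤
      Real.exp (-(renyiConst α B * (Real.exp b * min 1 ((a - b) ^ 2)))) := by
  refine (affinity_le_of_bhattacharyya hα₀ hα₁ (Real.sigmoid_pos b) (Real.sigmoid_lt_one b)
    (Real.sigmoid_pos a) (Real.sigmoid_lt_one a)).trans ?_
  have h1 := one_sub_bhattacharyya_ge (a := a) hb
  have h2 : 0 < min α (1 - α) := lt_min hα₀ (by linarith)
  have h3 := mul_le_mul_of_nonneg_left h1 h2.le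
  have h4 : min α (1 - α) * (Real.exp b * min 1 ((a - b) ^ 2) / (18 * (1 + Real.exp B) ^ 2)) =
      renyiConst α B * (Real.exp b * min 1 ((a - b) ^ 2)) / 2 := by
    rw [renyiConst]; field_simp; ring
  rw [h4] at h3
  linarith [Real.add_one_le_exp (-(renyiConst α B * (Real.exp b * min 1 ((a - b) ^ 2))))]

/-! ### Likelihood moments -/

lemma sum_network_prod {n : ℕ} (f : Dyad n → Bool → ℝ) :
    ∑ Y : Network n, ∏ e, f e (Y e) = ∏ e, (f e true + f e false) := by
  have := (Finset.prod_univ_sum (fun _ : Dyad n => (Finset.univ : Finset Bool)) f).symm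
  rw [Fintype.piFinset_univ] at this
  simpa using this

lemma likelihood_pos {n d : ℕ} (Y : Network n) (x : Rows n d) (β : ℝ) : 0 < likelihood Y x β := by
  refine Finset.prod_pos fun e _ => ?_
  split_ifs
  · exact Real.sigmoid_pos _
  · linarith [Real.sigmoid_lt_one (logOdds x β e)]

lemma networkLaw_real_singleton {n d : ℕ} (x : Rows n d) (β : ℝ) (Y : Network n) :
    (networkLaw x β).real {Y} = likelihood Y x β := by
  rw [networkLaw, measureReal_def, Measure.pi_singleton, ENNReal.toReal_prod, likelihood]
  refine Finset.prod_congr rfl fun e _ => ?_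
  rw [← measureReal_def, bernoulliMeasure_real_apply _ (by measurability)]
  cases Y e <;> simp <;> rfl

lemma sum_likelihood_rpow_le {n d : ℕ} {α B : ℝ} (hα₀ : 0 < α) (hα₁ : α < 1) (x xs : Rows n d)
    (β βs : ℝ) (hB : ∀ e : Dyad n, logOdds xs βs e ≤ B) :
    ∑ Y : Network n, likelihood Y x β ^ α * likelihood Y xs βs ^ (1 - α) ≤
      Real.exp (-(renyiConst α B * ∑ e : Dyad n, Real.exp (logOdds xs βs e) *
        min 1 ((logOdds x β e - logOdds xs βs e) ^ 2))) := by
  let f : Dyad n → Bool → ℝ := fun e y =>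
    (if y then Real.sigmoid (logOdds x β e) else 1 - Real.sigmoid (logOdds x β e)) ^ α *
    (if y then Real.sigmoid (logOdds xs βs e) else 1 - Real.sigmoid (logOdds xs βs e)) ^ (1 - α)
  have key : ∀ Y : Network n, likelihood Y x β ^ α * likelihood Y xs βs ^ (1 - α) =
      ∏ e, f e (Y e) := by
    intro Y
    rw [likelihood, likelihood, ← Real.finsetProd_rpow, ← Real.finsetProd_rpow,
      ← Finset.prod_mul_distrib]
    all_goals
      intro e _
      split_ifs
      · exact (Real.sigmoid_pos _).le
      · exact sub_nonneg.2 (Real.sigmoid_le_one _)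
  rw [Finset.sum_congr rfl fun Y _ => key Y, sum_network_prod, Finset.mul_sum, ← Finset.sum_neg_distrib, Real.exp_sum]
  refine Finset.prod_le_prod (fun e _ => ?_) fun e _ => ?_
  · have h1 := Real.sigmoid_le_one (logOdds x β e)
    have h2 := Real.sigmoid_le_one (logOdds xs βs e)
    have h3 := Real.sigmoid_nonneg (logOdds x β e)
    have h4 := Real.sigmoid_nonneg (logOdds xs βs e)
    have h5 := sub_nonneg.2 h1
    have h6 := sub_nonneg.2 h2
    simp only [f, if_true, Bool.false_eq_true, if_false]
    positivity
  · simpa [f] using affinity_sigmoid_le hα₀ hα₁ (hB e)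

lemma sum_likelihood_sq_div_le {n d : ℕ} (x xs : Rows n d) (β βs : ℝ) :
    ∑ Y : Network n, likelihood Y xs βs ^ 2 / likelihood Y x β ≤
      Real.exp ((∑ e : Dyad n, (logOdds x β e - logOdds xs βs e) ^ 2) / 2) := by
  let f : Dyad n → Bool → ℝ := fun e y =>
    (if y then Real.sigmoid (logOdds xs βs e) else 1 - Real.sigmoid (logOdds xs βs e)) ^ 2 /
    (if y then Real.sigmoid (logOdds x β e) else 1 - Real.sigmoid (logOdds x β e))
  have key : ∀ Y : Network n, likelihood Y xs βs ^ 2 / likelihood Y x β =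
      ∏ e, f e (Y e) := by
    intro Y
    rw [likelihood, likelihood, ← Finset.prod_pow, ← Finset.prod_div_distrib]
  rw [Finset.sum_congr rfl fun Y _ => key Y, sum_network_prod, Finset.sum_div, Real.exp_sum]
  refine Finset.prod_le_prod (fun e _ => ?_) fun e _ => ?_
  · have h1 := Real.sigmoid_nonneg (logOdds x β e)
    have h2 := sub_nonneg.2 (Real.sigmoid_le_one (logOdds x β e))
    simp only [f, if_true, Bool.false_eq_true, if_false]
    positivity
  · simpa [f] using sq_div_sigmoid_add_le (logOdds x β e) (logOdds xs βs e)

/-! ### Concentration of fractional posteriors -/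

lemma measurable_logOdds {n d : ℕ} (e : Dyad n) :
    Measurable fun θ : Rows n d × ℝ => logOdds θ.1 θ.2 e := by
  unfold logOdds dotProduct
  fun_prop

lemma measurable_likelihood {n d : ℕ} (Y : Network n) :
    Measurable fun θ : Rows n d × ℝ => likelihood Y θ.1 θ.2 := by
  unfold likelihood
  refine Finset.measurable_prod _ fun e _ => ?_
  have h : Measurable fun θ : Rows n d × ℝ => Real.sigmoid (logOdds θ.1 θ.2 e) :=
    continuous_sigmoid.measurable.comp (measurable_logOdds e)
  split_ifs
  · exact h
  · exact h.const_sub 1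

instance {n d : ℕ} (x : Rows n d) (β : ℝ) : IsProbabilityMeasure (networkLaw x β) := by
  unfold networkLaw; infer_instance

/-- Tonelli over a finite sample space: moment bounds at fixed `θ` pass to prior integrals. The
bound is asked only almost everywhere because the restricted prior lives on the bounded region only
up to a null set. -/
lemma lintegral_networkLaw_lintegral_le {n d : ℕ} {Θ : Type*} [MeasurableSpace Θ]
    (prior : Measure Θ) {V : Set Θ} (hV : MeasurableSet V) (xs : Rows n d) (βs : ℝ)
    {h : Network n → Θ → ℝ} (hm : ∀ Y, Measurable (h Y)) (h0 : ∀ Y θ, 0 ≤ h Y θ) {c : ℝ}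
    (hc : ∀ᵐ θ ∂prior, θ ∈ V → ∑ Y, h Y θ * likelihood Y xs βs ≤ c) :
    ∫⁻ Y, ∫⁻ θ in V, ENNReal.ofReal (h Y θ) ∂prior ∂(networkLaw xs βs) ≤
      ENNReal.ofReal c * prior V := by
  rw [lintegral_fintype]
  have h1 : ∀ Y, (networkLaw xs βs) {Y} = ENNReal.ofReal (likelihood Y xs βs) := fun Y => by
    rw [← networkLaw_real_singleton, ofReal_measureReal]
  have h2 : ∀ Y, (∫⁻ θ in V, ENNReal.ofReal (h Y θ) ∂prior) * (networkLaw xs βs) {Y} =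
      ∫⁻ θ in V, ENNReal.ofReal (h Y θ * likelihood Y xs βs) ∂prior := fun Y => by
    rw [h1, ← lintegral_mul_const _ (hm Y).ennreal_ofReal]
    simp_rw [ENNReal.ofReal_mul (h0 Y _)]
  simp_rw [h2]
  rw [← lintegral_finsetSum _ fun Y _ => ((hm Y).mul_const _).ennreal_ofReal]
  calc ∫⁻ θ in V, ∑ Y, ENNReal.ofReal (h Y θ * likelihood Y xs βs) ∂prior
      ≤ ∫⁻ _ in V, ENNReal.ofReal c ∂prior := by
        refine lintegral_mono_ae ?_
        rw [ae_restrict_iff' hV]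
        filter_upwards [hc] with θ hθ hθV
        rw [← ENNReal.ofReal_sum_of_nonneg
          fun Y _ => mul_nonneg (h0 Y θ) (likelihood_pos Y xs βs).le]
        exact ENNReal.ofReal_le_ofReal (hθ hθV)
    _ = _ := by rw [setLIntegral_const]

/-- If `x ≤ c` then `x^(-α) ≥ c^(-α) ≥ 1/c`; otherwise `x/c ≥ 1`. With `x = L*/L`, an upper bound on
`∫ L*/L` becomes a lower bound on `∫ (L/L*)^α`. -/
lemma one_le_mul_rpow_neg_add_div {α c x : ℝ} (hα₁ : α ≤ 1) (hc : 1 ≤ c)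
    (hα₀ : 0 ≤ α) (hx : 0 < x) : 1 ≤ c * x ^ (-α) + x / c := by
  have hc0 : 0 < c := by linarith
  have h1 : 0 ≤ x ^ (-α) := Real.rpow_nonneg hx.le _
  rcases le_total x c with h | h
  · have h2 : c ^ (-1 : ℝ) ≤ x ^ (-α) :=
      (Real.rpow_le_rpow_of_exponent_le hc (by linarith)).trans
        (Real.rpow_le_rpow_of_nonpos hx h (by linarith))
    rw [Real.rpow_neg_one] at h2
    have h3 := mul_le_mul_of_nonneg_left h2 hc0.le
    rw [mul_inv_cancel₀ hc0.ne'] at h3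
    have : 0 ≤ x / c := by positivity
    linarith
  · have : 1 ≤ x / c := (one_le_div hc0).2 h
    have : 0 ≤ c * x ^ (-α) := by positivity
    linarith

/-- If the `α`-affinity to the truth is at most `a` on `U`, and the second moment of the likelihood
ratio is at most `b` on a set `V` of prior mass at least `m`, then the fractional posterior of `U`
is at most `4 a b k² / m` with probability at least `1 - 2 / k`. -/
lemma fractionalPosterior_le_with_high_probability {n d : ℕ} (prior : Measure (Rows n d × ℝ))
    [IsProbabilityMeasure prior] {α : ℝ} (hα₀ : 0 < α) (hα₁ : α < 1) (xs : Rows n d) (βs : ℝ)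
    {U V : Set (Rows n d × ℝ)} (hU : MeasurableSet U) (hV : MeasurableSet V)
    {a b m k : ℝ} (ha : 0 < a) (hb : 1 ≤ b) (hm : 0 < m) (hk : 1 ≤ k)
    (hUa : ∀ᵐ θ ∂prior, θ ∈ U →
      ∑ Y : Network n, likelihood Y θ.1 θ.2 ^ α * likelihood Y xs βs ^ (1 - α) ≤ a)
    (hVb : ∀ θ ∈ V, ∑ Y : Network n, likelihood Y xs βs ^ 2 / likelihood Y θ.1 θ.2 ≤ b)
    (hmV : m ≤ prior.real V) :
    1 - 2 / k ≤ (networkLaw xs βs).real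
      {Y | fractionalPosterior prior α Y U ≤ ENNReal.ofReal (4 * a * b * k ^ 2 / m)} := by
  set μ := networkLaw xs βs
  set w : Network n → ℝ := fun Y => likelihood Y xs βs with hw
  have hw0 : ∀ Y, 0 < w Y := fun Y => likelihood_pos Y xs βs
  set l : Network n → Rows n d × ℝ → ℝ := fun Y θ => likelihood Y θ.1 θ.2 with hl
  have hl0 : ∀ Y θ, 0 < l Y θ := fun Y θ => likelihood_pos Y θ.1 θ.2
  have hlm : ∀ Y, Measurable (l Y) := measurable_likelihood
  have hmV' : ENNReal.ofReal m ≤ prior V := by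
    rw [← ofReal_measureReal]; exact ENNReal.ofReal_le_ofReal hmV
  have hV0 : prior V ≠ 0 := (lt_of_lt_of_le (ENNReal.ofReal_pos.2 hm) hmV').ne'
  have hVt : prior V ≠ ⊤ := measure_ne_top _ _
  have hk0 : 0 < k := by linarith
  have hb0 : 0 < b := by linarith
  -- numerator
  set N : Network n → ENNReal := fun Y => ∫⁻ θ in U, ENNReal.ofReal (w Y ^ (-α) * l Y θ ^ α) ∂prior
  have hN : ∫⁻ Y, N Y ∂μ ≤ ENNReal.ofReal a := by
    refine (lintegral_networkLaw_lintegral_le prior hU xs βs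
      (fun Y => ((hlm Y).pow_const α).const_mul _)
      (fun Y θ => mul_nonneg (Real.rpow_nonneg (hw0 Y).le _) (Real.rpow_nonneg (hl0 Y θ).le _))
      (c := a) ?_).trans ?_
    · filter_upwards [hUa] with θ hθ hθU
      refine le_trans (le_of_eq (Finset.sum_congr rfl fun Y _ => ?_)) (hθ hθU)
      rw [show 1 - α = -α + 1 by ring, Real.rpow_add (likelihood_pos Y xs βs), Real.rpow_one]
      ring
    · calc _ ≤ ENNReal.ofReal a * 1 := by gcongr; exact prob_le_one
        _ = _ := mul_one _
  have hNbad : μ {Y | ENNReal.ofReal (a * k) ≤ N Y} ≤ ENNReal.ofReal (1 / k) := by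
    refine (meas_ge_le_lintegral_div (Measurable.of_discrete).aemeasurable
      (ENNReal.ofReal_pos.2 (by positivity)).ne' ENNReal.ofReal_ne_top).trans ?_
    calc _ ≤ ENNReal.ofReal a / ENNReal.ofReal (a * k) := by gcongr
      _ = _ := by
        rw [← ENNReal.ofReal_div_of_pos (by positivity)]; congr 1; field_simp
  -- denominator
  set G : Network n → ENNReal := fun Y => ∫⁻ θ in V, ENNReal.ofReal (w Y / l Y θ) ∂prior
  have hG : ∫⁻ Y, G Y ∂μ ≤ ENNReal.ofReal b * prior V := by
    refine lintegral_networkLaw_lintegral_le prior hV xs βs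
      (fun Y => (hlm Y).const_div _) (fun Y θ => (div_pos (hw0 Y) (hl0 Y θ)).le) (c := b) ?_
    filter_upwards with θ hθ
    refine le_trans (le_of_eq (Finset.sum_congr rfl fun Y _ => ?_)) (hVb θ hθ)
    simp only [hw, hl]
    ring
  have hGbad : μ {Y | ENNReal.ofReal (b * k) * prior V ≤ G Y} ≤ ENNReal.ofReal (1 / k) := by
    refine (meas_ge_le_lintegral_div (Measurable.of_discrete).aemeasurable
      (mul_ne_zero (ENNReal.ofReal_pos.2 (by positivity)).ne' hV0)
      (ENNReal.mul_ne_top ENNReal.ofReal_ne_top hVt)).trans ?_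
    calc _ ≤ ENNReal.ofReal b * prior V / (ENNReal.ofReal (b * k) * prior V) := by gcongr
      _ = _ := by
        rw [ENNReal.mul_div_mul_right _ _ hV0 hVt, ← ENNReal.ofReal_div_of_pos (by positivity)]
        congr 1; field_simp
  have hbad : μ.real ({Y | ENNReal.ofReal (a * k) ≤ N Y} ∪
      {Y | ENNReal.ofReal (b * k) * prior V ≤ G Y}) ≤ 2 / k := by
    refine (measureReal_union_le _ _).trans ?_
    have h1 := ENNReal.toReal_le_of_le_ofReal (by positivity) hNbad
    have h2 := ENNReal.toReal_le_of_le_ofReal (by positivity) hGbad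
    rw [measureReal_def, measureReal_def]
    calc _ ≤ 1 / k + 1 / k := add_le_add h1 h2
      _ = _ := by ring
  have hcompl := probReal_compl_eq_one_sub (μ := μ) (s := {Y | ENNReal.ofReal (a * k) ≤ N Y} ∪
      {Y | ENNReal.ofReal (b * k) * prior V ≤ G Y}) (MeasurableSet.of_discrete)
  refine le_trans (by rw [hcompl]; linarith) (measureReal_mono ?_)
  intro Y hY
  simp only [Set.mem_compl_iff, Set.mem_union, Set.mem_ofPred_eq, not_or, not_le] at hY
  obtain ⟨hY1, hY2⟩ := hY
  -- With this `c`, the term `G Y / c` uses up at most half of the prior mass of `V`.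
  set c := 2 * b * k with hc
  have hc1 : 1 ≤ c := by nlinarith
  have hc0 : 0 < c := by linarith
  have hs0 : 0 < w Y ^ (-α) := Real.rpow_pos_of_pos (hw0 Y) _
  set s := ENNReal.ofReal (w Y ^ (-α)) with hs
  have hs_ne : s ≠ 0 := (ENNReal.ofReal_pos.2 hs0).ne'
  have hs_top : s ≠ ⊤ := ENNReal.ofReal_ne_top
  set den := ∫⁻ θ, ENNReal.ofReal (l Y θ ^ α) ∂prior with hden
  have hF : Measurable fun θ => ENNReal.ofReal (l Y θ ^ α) := ((hlm Y).pow_const α).ennreal_ofReal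
  have hNs : N Y = s * ∫⁻ θ in U, ENNReal.ofReal (l Y θ ^ α) ∂prior := by
    rw [← lintegral_const_mul _ hF]
    simp only [N]
    simp_rw [ENNReal.ofReal_mul hs0.le]
    rfl
  have hpost : fractionalPosterior prior α Y U = (s * den)⁻¹ * N Y := by
    rw [fractionalPosterior, Measure.smul_apply, withDensity_apply _ hU, smul_eq_mul, hNs,
      ENNReal.mul_inv (Or.inl hs_ne) (Or.inl hs_top)]
    calc _ = (s⁻¹ * s) * (den⁻¹ * ∫⁻ θ in U, ENNReal.ofReal (l Y θ ^ α) ∂prior) := by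
          rw [ENNReal.inv_mul_cancel hs_ne hs_top, one_mul]
      _ = _ := by ring
  have hlow : prior V ≤ ENNReal.ofReal c * (s * den) + ENNReal.ofReal (1 / c) * G Y := by
    calc prior V = ∫⁻ _ in V, 1 ∂prior := by rw [setLIntegral_one]
      _ ≤ ∫⁻ θ in V, (ENNReal.ofReal c * (s * ENNReal.ofReal (l Y θ ^ α)) +
            ENNReal.ofReal (1 / c) * ENNReal.ofReal (w Y / l Y θ)) ∂prior := by
          refine lintegral_mono fun θ => ?_
          have h := one_le_mul_rpow_neg_add_div hα₁.le hc1 hα₀.le (div_pos (hw0 Y) (hl0 Y θ))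
          have e : (w Y / l Y θ) ^ (-α) = w Y ^ (-α) * l Y θ ^ α := by
            rw [Real.div_rpow (hw0 Y).le (hl0 Y θ).le, Real.rpow_neg (hl0 Y θ).le, div_inv_eq_mul]
          rw [e] at h
          have hlp : 0 < l Y θ ^ α := Real.rpow_pos_of_pos (hl0 Y θ) _
          have hr := div_pos (hw0 Y) (hl0 Y θ)
          rw [hs, ← ENNReal.ofReal_mul hs0.le, ← ENNReal.ofReal_mul hc0.le,
            ← ENNReal.ofReal_mul (by positivity), ← ENNReal.ofReal_add (by positivity)
            (by positivity), ← ENNReal.ofReal_one]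
          refine ENNReal.ofReal_le_ofReal (h.trans (le_of_eq ?_))
          ring
      _ = ENNReal.ofReal c * (s * ∫⁻ θ in V, ENNReal.ofReal (l Y θ ^ α) ∂prior) +
            ENNReal.ofReal (1 / c) * G Y := by
          rw [lintegral_add_left ((hF.const_mul s).const_mul _), lintegral_const_mul _
            (hF.const_mul s), lintegral_const_mul _ hF, lintegral_const_mul _
            ((hlm Y).const_div _).ennreal_ofReal]
      _ ≤ _ := by
          gcongr
          exact setLIntegral_le_lintegral _ _
  have hhalf : ENNReal.ofReal (1 / c) * G Y ≤ prior V / 2 := by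
    calc _ ≤ ENNReal.ofReal (1 / c) * (ENNReal.ofReal (b * k) * prior V) := by gcongr
      _ = ENNReal.ofReal (1 / 2) * prior V := by
          rw [← mul_assoc, ← ENNReal.ofReal_mul (by positivity)]
          congr 2
          rw [hc]; field_simp
      _ = _ := by
          rw [ENNReal.ofReal_div_of_pos (by norm_num), ENNReal.div_eq_inv_mul,
            ENNReal.ofReal_one, mul_one, ENNReal.div_eq_inv_mul]
          norm_num
  have hden_low : ENNReal.ofReal (m / (2 * c)) ≤ s * den := by
    have h1 : prior V / 2 ≤ ENNReal.ofReal c * (s * den) := by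
      have h2 : prior V / 2 + prior V / 2 ≤ ENNReal.ofReal c * (s * den) + prior V / 2 := by
        rw [ENNReal.add_halves]
        exact hlow.trans (by gcongr)
      exact (ENNReal.add_le_add_iff_right (ENNReal.div_ne_top hVt (by norm_num))).1 h2
    have h3 : ENNReal.ofReal (m / (2 * c)) = ENNReal.ofReal (1 / c) * (ENNReal.ofReal m / 2) := by
      rw [show m / (2 * c) = 1 / c * (m / 2) by field_simp, ENNReal.ofReal_mul (by positivity),
        ENNReal.ofReal_div_of_pos (by norm_num : (0:ℝ) < 2)]
      norm_num
    rw [h3]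
    calc _ ≤ ENNReal.ofReal (1 / c) * (prior V / 2) := by gcongr
      _ ≤ ENNReal.ofReal (1 / c) * (ENNReal.ofReal c * (s * den)) := by gcongr
      _ = s * den := by
        rw [← mul_assoc, ← ENNReal.ofReal_mul (by positivity), one_div_mul_cancel hc0.ne',
          ENNReal.ofReal_one, one_mul]
  rw [Set.mem_ofPred_eq, hpost]
  calc (s * den)⁻¹ * N Y ≤ (ENNReal.ofReal (m / (2 * c)))⁻¹ * ENNReal.ofReal (a * k) := by
        gcongr
    _ = _ := by
        rw [← ENNReal.ofReal_inv_of_pos (by positivity), ← ENNReal.ofReal_mul (by positivity)]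
        congr 1
        rw [hc]; field_simp
        ring

/-! ### Small-ball probabilities of the horseshoe law -/

lemma le_withDensity_real_Icc {f : ℝ → ENNReal} {a b c : ℝ} (hc : 0 ≤ c)
    [IsFiniteMeasure (volume.withDensity f)] (hf : ∀ x ∈ Set.Icc a b, ENNReal.ofReal c ≤ f x) :
    c * (b - a) ≤ (volume.withDensity f).real (Set.Icc a b) := by
  have h : ENNReal.ofReal (c * (b - a)) ≤ (volume.withDensity f) (Set.Icc a b) := by
    rw [withDensity_apply _ measurableSet_Icc, ENNReal.ofReal_mul hc, ← Real.volume_Icc,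
      ← setLIntegral_const]
    exact setLIntegral_mono' measurableSet_Icc hf
  exact (ENNReal.ofReal_le_iff_le_toReal (measure_ne_top _ _)).1 h

lemma cauchyMeasure_std : cauchyMeasure 0 1 = volume.withDensity (cauchyPDF 0 1) :=
  cauchyMeasure_of_scale_ne_zero 0 one_ne_zero

lemma halfCauchy_real_Icc_ge {a b : ℝ} (ha : 0 ≤ a) :
    (b - a) / (4 * (1 + b ^ 2)) ≤ halfCauchy.real (Set.Icc a b) := by
  have h1 : halfCauchy.real (Set.Icc a b) =
      (cauchyMeasure 0 1).real ((fun t => |t|) ⁻¹' Set.Icc a b) :=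
    map_measureReal_apply (by fun_prop) measurableSet_Icc
  have h2 : Set.Icc a b ⊆ (fun t : ℝ => |t|) ⁻¹' Set.Icc a b := fun t ht => by
    simpa [abs_of_nonneg (ha.trans ht.1)] using ht
  rw [h1]
  refine le_trans ?_ (measureReal_mono h2)
  have : IsFiniteMeasure (volume.withDensity (cauchyPDF 0 1)) := by
    rw [← cauchyMeasure_std]; infer_instance
  rw [cauchyMeasure_std]
  refine le_trans (le_of_eq ?_) (le_withDensity_real_Icc (c := 1 / (4 * (1 + b ^ 2)))
    (by positivity) fun x hx => ?_)
  · ring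
  · rw [cauchyPDF, cauchyPDFReal]
    refine ENNReal.ofReal_le_ofReal ?_
    simp only [NNReal.coe_one, mul_one, sub_zero, one_pow]
    rw [← mul_inv, one_div]
    have hx0 : 0 ≤ x := ha.trans hx.1
    have hxb : x ^ 2 ≤ b ^ 2 := pow_le_pow_left₀ hx0 hx.2 2
    refine inv_anti₀ (by positivity) ?_
    exact mul_le_mul Real.pi_le_four (by linarith) (by positivity) (by norm_num)

lemma arctan_le_self {x : ℝ} (hx : 0 ≤ x) : Real.arctan x ≤ x := by
  have := Real.le_tan (Real.arctan_nonneg.2 hx) (Real.arctan_lt_pi_div_two x)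
  rwa [Real.tan_arctan] at this

lemma halfCauchy_real_Icc_zero_ge {b : ℝ} (hb : 0 < b) :
    1 - 1 / b ≤ halfCauchy.real (Set.Icc 0 b) := by
  have h1 : halfCauchy.real (Set.Icc 0 b) =
      (cauchyMeasure 0 1).real ((fun t => |t|) ⁻¹' Set.Icc 0 b) :=
    map_measureReal_apply (by fun_prop) measurableSet_Icc
  have h2 : (fun t : ℝ => |t|) ⁻¹' Set.Icc 0 b = Set.Icc (-b) b := by
    ext t; simp [abs_le]
  have h3 : (cauchyMeasure 0 1).real (Set.Icc (-b) b) = Real.pi⁻¹ * (2 * Real.arctan b) := by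
    rw [cauchyMeasure_std, measureReal_def, withDensity_apply _ measurableSet_Icc]
    simp only [cauchyPDF]
    rw [← integral_eq_lintegral_of_nonneg_ae
      (ae_of_all _ fun x => (cauchyPDF_pos 0 one_ne_zero x).le)
      (measurable_cauchyPDFReal 0 1).aestronglyMeasurable,
      integral_Icc_eq_integral_Ioc, ← intervalIntegral.integral_of_le (by linarith)]
    simp only [cauchyPDFReal, NNReal.coe_one, mul_one, sub_zero, one_pow]
    rw [intervalIntegral.integral_const_mul]
    have : ∀ x : ℝ, (x ^ 2 + 1)⁻¹ = (1 + x ^ 2)⁻¹ := fun x => by rw [add_comm]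
    simp_rw [this]
    rw [integral_inv_one_add_sq, Real.arctan_neg]
    ring
  rw [h1, h2, h3]
  have h4 : Real.arctan b⁻¹ ≤ b⁻¹ := arctan_le_self (by positivity)
  rw [Real.arctan_inv_of_pos hb] at h4
  have hpi := Real.pi_gt_three
  have h5 : Real.pi⁻¹ * (Real.pi - 2 * b⁻¹) ≤ Real.pi⁻¹ * (2 * Real.arctan b) := by
    gcongr; linarith
  refine le_trans ?_ h5
  rw [mul_sub, inv_mul_cancel₀ (by positivity), one_div]
  have h6 : Real.pi⁻¹ * 2 ≤ 1 := by
    rw [inv_mul_le_iff₀ (by positivity)]; linarith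
  have h7 : Real.pi⁻¹ * 2 * b⁻¹ ≤ 1 * b⁻¹ := by gcongr
  linarith

lemma gaussianReal_real_Icc_ge {v r : ℝ} (hv : |v| ≤ 1) (hr₀ : 0 ≤ r) (hr₁ : r ≤ 1) :
    r / 10 ≤ (gaussianReal 0 1).real (Set.Icc (v - r) (v + r)) := by
  have hg : gaussianReal 0 1 = volume.withDensity (gaussianPDF 0 1) :=
    gaussianReal_of_var_ne_zero 0 one_ne_zero
  have : IsFiniteMeasure (volume.withDensity (gaussianPDF 0 1)) := by
    rw [← hg]; infer_instance
  rw [hg]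
  -- The interval has length `2r` and lies in `[-2, 2]`, where the density is at least `e^(-2)/√(2π)
  -- ≥ 1/20`.
  refine le_trans (le_of_eq ?_) (le_withDensity_real_Icc (c := 1 / 20) (by norm_num)
    fun x hx => ?_)
  · ring
  · rw [gaussianPDF, gaussianPDFReal]
    refine ENNReal.ofReal_le_ofReal ?_
    simp only [NNReal.coe_one, mul_one, sub_zero]
    obtain ⟨hv1, hv2⟩ := abs_le.1 hv
    have hx2 : x ^ 2 ≤ 4 := by nlinarith [hx.1, hx.2]
    have h1 : Real.exp (-2) ≤ Real.exp (-x ^ 2 / 2) := Real.exp_le_exp.2 (by linarith)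
    have h2 : √(2 * Real.pi) ≤ 2.6 :=
      Real.sqrt_le_iff.2 ⟨by norm_num, by nlinarith [Real.pi_lt_d2]⟩
    have h3 : Real.exp 2 ≤ 7.4 := by
      rw [show (2 : ℝ) = 1 + 1 by norm_num, Real.exp_add]
      nlinarith [Real.exp_one_lt_d9, Real.exp_pos 1]
    have h4 : (1 : ℝ) / 20 ≤ (√(2 * Real.pi) * Real.exp 2)⁻¹ := by
      rw [one_div]
      refine inv_anti₀ (by positivity) ?_
      calc √(2 * Real.pi) * Real.exp 2 ≤ 2.6 * 7.4 := by gcongr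
        _ ≤ 20 := by norm_num
    refine h4.trans ?_
    rw [mul_inv, ← Real.exp_neg]
    gcongr

/-- Chebyshev is enough: this is used at `b = 2N²` for at most `N` coordinates per row. -/
lemma gaussianReal_real_Icc_symm_ge {b : ℝ} (hb : 0 < b) :
    1 - 1 / b ^ 2 ≤ (gaussianReal 0 1).real (Set.Icc (-b) b) := by
  have h := meas_ge_le_variance_div_sq (μ := gaussianReal 0 1) (X := fun x => x)
    (memLp_id_gaussianReal 2) hb
  rw [integral_id_gaussianReal, variance_fun_id_gaussianReal] at h
  have h2 := ENNReal.toReal_le_of_le_ofReal (by positivity) h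
  have h3 := probReal_compl_eq_one_sub (μ := gaussianReal 0 1)
    (s := {x : ℝ | b ≤ |x - 0|}) (measurableSet_le (by fun_prop) (by fun_prop))
  have h4 : {x : ℝ | b ≤ |x - 0|}ᶜ ⊆ Set.Icc (-b) b := fun x hx => by
    simp only [sub_zero, Set.mem_compl_iff, Set.mem_ofPred_eq, not_le] at hx
    exact abs_le.1 hx.le
  refine le_trans ?_ (measureReal_mono h4)
  rw [h3]
  have h5 : (gaussianReal 0 1).real {x : ℝ | b ≤ |x - 0|} ≤ 1 / b ^ 2 := by
    simpa [measureReal_def] using h2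
  linarith

lemma measureReal_pi_pi {ι : Type*} [Fintype ι] {X : ι → Type*} [∀ i, MeasurableSpace (X i)]
    (μ : ∀ i, Measure (X i)) [∀ i, SigmaFinite (μ i)] (s : ∀ i, Set (X i)) :
    (Measure.pi μ).real (Set.univ.pi s) = ∏ i, (μ i).real (s i) := by
  rw [measureReal_def, Measure.pi_pi, ENNReal.toReal_prod]; rfl

lemma half_le_one_sub_pow {r : ℝ} {m : ℕ} (hr₁ : r ≤ 1) (hm : m * r ≤ 1 / 2) :
    1 / 2 ≤ (1 - r) ^ m := by
  have := one_add_mul_le_pow (a := -r) (by linarith) m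
  rw [← sub_eq_add_neg] at this
  linarith

/-- By Bernoulli's inequality all `m` near-one factors together cost only `1/2`, so the price
depends on the sparsity and not on the dimension. -/
lemma sparse_prod_ge {m s : ℕ} {f : Fin m → ℝ} {A : Finset (Fin m)} {q r : ℝ} (hq₀ : 0 ≤ q)
    (hq₁ : q ≤ 1) (hr₀ : 0 ≤ r) (hr₁ : r ≤ 1) (hA : A.card ≤ s) (hm : m * r ≤ 1 / 2)
    (hfA : ∀ j ∈ A, q ≤ f j) (hf : ∀ j ∉ A, 1 - r ≤ f j) : q ^ s / 2 ≤ ∏ j, f j := by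
  classical
  calc q ^ s / 2 = q ^ s * (1 / 2) := by ring
    _ ≤ q ^ A.card * (1 - r) ^ m := by
        gcongr ?_ * ?_
        · exact pow_le_pow_of_le_one hq₀ hq₁ hA
        · exact half_le_one_sub_pow hr₁ hm
    _ = ∏ j, (if j ∈ A then q else 1) * (1 - r) := by
        rw [Finset.prod_mul_distrib, Finset.prod_ite_mem, Finset.univ_inter, Finset.prod_const,
          Finset.prod_const, Finset.card_univ, Fintype.card_fin]
    _ ≤ ∏ j, f j := by
        refine Finset.prod_le_prod (fun j _ => ?_) fun j _ => ?_
        · split_ifs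
          · exact mul_nonneg hq₀ (by linarith)
          · linarith
        · split_ifs with hj
          · exact (mul_le_of_le_one_right hq₀ (by linarith)).trans (hfA j hj)
          · simpa using hf j hj

/-- The base scales multiply to `8N⁵ · 1/(8N⁴) = N`, so `g` near `v/N` reaches `v`. With tolerance
`ρ = 1/(8N²)` the errors total at most `7Nρ`, below `8Nρ = 1/N`. -/
lemma abs_active_scale_mul_sub_le {N τ l g v : ℝ} (hN : 2 ≤ N) (hv : |v| ≤ N)
    (hτ : τ ∈ Set.Icc (1 / (8 * N ^ 4)) (1 / (8 * N ^ 4) * (1 + 1 / (8 * N ^ 2))))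
    (hl : l ∈ Set.Icc (8 * N ^ 5) (8 * N ^ 5 * (1 + 1 / (8 * N ^ 2))))
    (hg : g ∈ Set.Icc (v / N - 1 / (8 * N ^ 2)) (v / N + 1 / (8 * N ^ 2))) :
    |l * τ * g - v| ≤ 1 / N := by
  have hN0 : 0 < N := by linarith
  have hN2 : 1 ≤ N ^ 2 := one_le_pow₀ (by linarith)
  have he : 8 * N * (1 / (8 * N ^ 2)) = 1 / N := by field_simp
  have hut : 8 * N ^ 5 * (1 / (8 * N ^ 4)) = N := by field_simp
  have hρ0 : 0 < 1 / (8 * N ^ 2) := by positivity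
  have hρ1 : 1 / (8 * N ^ 2) ≤ 1 := by rw [div_le_one (by positivity)]; linarith
  have ht0 : 0 < 1 / (8 * N ^ 4) := by positivity
  have hu0 : 0 < 8 * N ^ 5 := by positivity
  generalize 1 / (8 * N ^ 2) = ρ at *
  generalize 1 / (8 * N ^ 4) = t at *
  generalize 8 * N ^ 5 = u at *
  have hτ0 : 0 < τ := ht0.trans_le hτ.1
  have hl0 : 0 < l := hu0.trans_le hl.1
  have h1 : N ≤ l * τ := by
    rw [← hut]; exact mul_le_mul hl.1 hτ.1 ht0.le hl0.le
  have h2 : l * τ ≤ N * (1 + 3 * ρ) := by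
    calc l * τ ≤ u * (1 + ρ) * (t * (1 + ρ)) := mul_le_mul hl.2 hτ.2 hτ0.le (by positivity)
      _ = N * (1 + ρ) ^ 2 := by rw [← hut]; ring
      _ ≤ N * (1 + 3 * ρ) := by gcongr; nlinarith
  have hvN : |v / N| ≤ 1 := by rwa [abs_div, abs_of_pos hN0, div_le_one hN0]
  have h3 : |g - v / N| ≤ ρ := abs_le.2 ⟨by linarith [hg.1], by linarith [hg.2]⟩
  have h4 : |v / N| * (3 * ρ * N) + l * τ * ρ ≤ 1 / N := by
    have a1 : l * τ * ρ ≤ N * (1 + 3 * ρ) * ρ := by gcongr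
    have a2 : |v / N| * (3 * ρ * N) ≤ 1 * (3 * ρ * N) := by gcongr
    have a3 : N * ρ * ρ ≤ N * ρ * 1 := by gcongr
    nlinarith
  have e : l * τ * g - v = v / N * (l * τ - N) + l * τ * (g - v / N) := by field_simp; ring
  rw [e]
  refine (abs_add_le _ _).trans (le_trans ?_ h4)
  rw [abs_mul, abs_mul, abs_of_pos (mul_pos hl0 hτ0), abs_of_nonneg (sub_nonneg.2 h1)]
  gcongr
  linarith

/-- The same small `τ` shrinks rows with typical `λ` and `g`: `2N · 2/(8N⁴) · 2N² = 1/N`. This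
dictates the order of the global scale. -/
lemma abs_inactive_scale_mul_le {N τ l g : ℝ} (hN : 2 ≤ N)
    (hτ : τ ∈ Set.Icc (1 / (8 * N ^ 4)) (1 / (8 * N ^ 4) * (1 + 1 / (8 * N ^ 2))))
    (hl : l ∈ Set.Icc 0 (2 * N)) (hg : g ∈ Set.Icc (-(2 * N ^ 2)) (2 * N ^ 2)) :
    |l * τ * g| ≤ 1 / N := by
  have hN0 : 0 < N := by linarith
  have hN2 : 1 ≤ N ^ 2 := one_le_pow₀ (by linarith)
  have hρ1 : 1 / (8 * N ^ 2) ≤ 1 := by rw [div_le_one (by positivity)]; linarith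
  have ht0 : 0 < 1 / (8 * N ^ 4) := by positivity
  have hτ0 : 0 < τ := ht0.trans_le hτ.1
  have hτ2 : τ ≤ 2 * (1 / (8 * N ^ 4)) := hτ.2.trans (by nlinarith)
  rw [abs_mul, abs_of_nonneg (mul_nonneg hl.1 hτ0.le)]
  calc l * τ * |g| ≤ 2 * N * (2 * (1 / (8 * N ^ 4))) * (2 * N ^ 2) := by
        gcongr
        · exact hl.2
        · exact abs_le.2 hg
    _ = 1 / N := by field_simp; norm_num

lemma halfCauchy_real_global_scale_ge {N : ℝ} (hN : 2 ≤ N) :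
    (1 / N) ^ 16 ≤ halfCauchy.real
      (Set.Icc (1 / (8 * N ^ 4)) (1 / (8 * N ^ 4) * (1 + 1 / (8 * N ^ 2)))) := by
  have hN0 : 0 < N := by linarith
  have hN2 : 1 ≤ N ^ 2 := one_le_pow₀ (by linarith)
  have hN4 : 1 ≤ N ^ 4 := one_le_pow₀ (by linarith)
  have hρ1 : 1 / (8 * N ^ 2) ≤ 1 := by rw [div_le_one (by positivity)]; linarith
  have ht1 : 1 / (8 * N ^ 4) ≤ 1 / 2 := by
    rw [div_le_div_iff₀ (by positivity) (by norm_num)]; linarith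
  have hprod : (1 / N) ^ 16 ≤ 1 / (8 * N ^ 4) * (1 / (8 * N ^ 2)) / 16 := by
    rw [one_div_pow, div_mul_div_comm, div_div, div_le_div_iff₀ (by positivity) (by positivity)]
    calc 1 * (8 * N ^ 4 * (8 * N ^ 2) * 16) = 2 ^ 10 * N ^ 6 := by ring
      _ ≤ N ^ 10 * N ^ 6 := by gcongr
      _ = _ := by ring
  refine le_trans ?_ (halfCauchy_real_Icc_ge (by positivity))
  have hρ0 : 0 < 1 / (8 * N ^ 2) := by positivity
  have ht0 : 0 < 1 / (8 * N ^ 4) := by positivity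
  generalize 1 / (8 * N ^ 2) = ρ at *
  generalize 1 / (8 * N ^ 4) = t at *
  have h1 : (t * (1 + ρ)) ^ 2 ≤ 1 := pow_le_one₀ (by positivity) (by nlinarith)
  calc (1 / N) ^ 16 ≤ t * ρ / 16 := hprod
    _ ≤ t * ρ / (4 * (1 + (t * (1 + ρ)) ^ 2)) := by gcongr; linarith
    _ = _ := by ring

lemma halfCauchy_real_local_scale_ge {N : ℝ} (hN : 2 ≤ N) :
    (1 / N) ^ 18 ≤ halfCauchy.real
      (Set.Icc (8 * N ^ 5) (8 * N ^ 5 * (1 + 1 / (8 * N ^ 2)))) := by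
  have hN0 : 0 < N := by linarith
  have hN2 : 1 ≤ N ^ 2 := one_le_pow₀ (by linarith)
  have hN5 : 1 ≤ N ^ 5 := one_le_pow₀ (by linarith)
  have hρ1 : 1 / (8 * N ^ 2) ≤ 1 := by rw [div_le_one (by positivity)]; linarith
  have hρ0 : 0 < 1 / (8 * N ^ 2) := by positivity
  refine le_trans ?_ (halfCauchy_real_Icc_ge (by positivity))
  have hu1 : 1 ≤ 8 * N ^ 5 := by linarith
  have hprod : (1 / N) ^ 18 ≤ 8 * N ^ 5 * (1 / (8 * N ^ 2)) / (4 * (8 * (8 * N ^ 5) ^ 2)) := by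
    rw [one_div_pow, show 8 * N ^ 5 * (1 / (8 * N ^ 2)) / (4 * (8 * (8 * N ^ 5) ^ 2)) =
      1 / (2 ^ 11 * N ^ 7) by field_simp; norm_num, div_le_div_iff₀ (by positivity) (by positivity)]
    calc 1 * (2 ^ 11 * N ^ 7) ≤ 1 * (N ^ 11 * N ^ 7) := by gcongr
      _ = _ := by ring
  generalize 1 / (8 * N ^ 2) = ρ at *
  generalize 8 * N ^ 5 = u at *
  have hu2 : 1 ≤ u ^ 2 := one_le_pow₀ hu1
  have hu0 : 0 < u := by linarith
  have h1 : (u * (1 + ρ)) ^ 2 ≤ (u * 2) ^ 2 := by gcongr; linarith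
  calc (1 / N) ^ 18 ≤ u * ρ / (4 * (8 * u ^ 2)) := hprod
    _ ≤ u * ρ / (4 * (1 + (u * (1 + ρ)) ^ 2)) := by gcongr; nlinarith
    _ = _ := by ring

lemma gaussianReal_real_active_ge {N v : ℝ} (hN : 2 ≤ N) (hv : |v| ≤ N) :
    (1 / N) ^ 9 ≤ (gaussianReal 0 1).real
      (Set.Icc (v / N - 1 / (8 * N ^ 2)) (v / N + 1 / (8 * N ^ 2))) := by
  have hN0 : 0 < N := by linarith
  have hN2 : 1 ≤ N ^ 2 := one_le_pow₀ (by linarith)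
  have hvN : |v / N| ≤ 1 := by rwa [abs_div, abs_of_pos hN0, div_le_one hN0]
  refine le_trans ?_ (gaussianReal_real_Icc_ge hvN (by positivity)
    (by rw [div_le_one (by positivity)]; linarith))
  rw [one_div_pow, div_div, div_le_div_iff₀ (by positivity) (by positivity)]
  calc 1 * (8 * N ^ 2 * 10) ≤ 2 ^ 7 * N ^ 2 := by nlinarith
    _ ≤ N ^ 7 * N ^ 2 := by gcongr
    _ = _ := by ring

lemma gaussianReal_real_inactive_prod_ge {N : ℝ} {d : ℕ} (hN : 2 ≤ N) (hdN : (d : ℝ) ≤ N) :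
    1 - 1 / (4 * N ^ 3) ≤
      ∏ _k : Fin d, (gaussianReal 0 1).real (Set.Icc (-(2 * N ^ 2)) (2 * N ^ 2)) := by
  have hN0 : 0 < N := by linarith
  have hN2 : 1 ≤ N ^ 2 := one_le_pow₀ (by linarith)
  have h0 : 1 / (2 * N ^ 2) ^ 2 ≤ 1 :=
    (div_le_one (by positivity)).2 (one_le_pow₀ (by linarith))
  have h1 := one_add_mul_le_pow (a := -(1 / (2 * N ^ 2) ^ 2)) (by linarith) d
  have h2 : (d : ℝ) * (1 / (2 * N ^ 2) ^ 2) ≤ N * (1 / (2 * N ^ 2) ^ 2) := by gcongr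
  have h3 : N * (1 / (2 * N ^ 2) ^ 2) = 1 / (4 * N ^ 3) := by field_simp; norm_num
  rw [← sub_eq_add_neg] at h1
  rw [Finset.prod_const, Finset.card_univ, Fintype.card_fin]
  refine le_trans (by linarith) (h1.trans ?_)
  exact pow_le_pow_left₀ (by linarith) (gaussianReal_real_Icc_symm_ge (by positivity)) d

/-- The horseshoe law puts mass at least `N ^ (-27 (1 + s) d)` on the sup-norm ball of radius
`1 / N` around an `s`-sparse array with entries bounded by `N`. -/
lemma horseshoe_small_ball {m d s : ℕ} (V : Rows m d) {N : ℝ} (hN : 2 ≤ N) (hd : 1 ≤ d)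
    (hmN : (m : ℝ) ≤ N) (hdN : (d : ℝ) ≤ N) (hV : ∀ j k, |V j k| ≤ N)
    (hs : {j | V j ≠ 0}.ncard ≤ s) :
    (1 / N) ^ (27 * (1 + s) * d) ≤
      (horseshoe m d).real {W | ∀ j k, |W j k - V j k| ≤ 1 / N} := by
  classical
  have hN0 : 0 < N := by linarith
  have hinv0 : 0 ≤ 1 / N := by positivity
  have hinv1 : 1 / N ≤ 1 := (div_le_one hN0).2 (by linarith)
  let A : Finset (Fin m) := Finset.univ.filter fun j => V j ≠ 0
  have hA : A.card ≤ s := by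
    refine le_trans (le_of_eq ?_) hs
    rw [← Set.ncard_coe_finset]; congr 1; ext j; simp [A]
  let It : Set ℝ := Set.Icc (1 / (8 * N ^ 4)) (1 / (8 * N ^ 4) * (1 + 1 / (8 * N ^ 2)))
  let Il : Fin m → Set ℝ := fun j =>
    if j ∈ A then Set.Icc (8 * N ^ 5) (8 * N ^ 5 * (1 + 1 / (8 * N ^ 2))) else Set.Icc 0 (2 * N)
  let Ig : Fin m → Fin d → Set ℝ := fun j k =>
    if j ∈ A then Set.Icc (V j k / N - 1 / (8 * N ^ 2)) (V j k / N + 1 / (8 * N ^ 2))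
    else Set.Icc (-(2 * N ^ 2)) (2 * N ^ 2)
  have hsub : It ×ˢ (Set.univ.pi Il ×ˢ Set.univ.pi fun j => Set.univ.pi (Ig j)) ⊆
      (fun w : ℝ × (Fin m → ℝ) × (Rows m d) => (fun j k => w.2.1 j * w.1 * w.2.2 j k : Rows m d))
        ⁻¹' {W | ∀ j k, |W j k - V j k| ≤ 1 / N} := by
    rintro ⟨τ, lam, g⟩ ⟨hτ, hlam, hg⟩ j k
    have hl := hlam j (Set.mem_univ _)
    have hgj := hg j (Set.mem_univ _) k (Set.mem_univ _)
    simp only [Il] at hl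
    simp only [Ig] at hgj
    show |lam j * τ * g j k - V j k| ≤ 1 / N
    by_cases hj : j ∈ A
    · rw [if_pos hj] at hl hgj
      exact abs_active_scale_mul_sub_le hN (hV j k) hτ hl hgj
    · rw [if_neg hj] at hl hgj
      have hV0 : V j k = 0 := by
        have : V j = 0 := by simpa [A] using hj
        rw [this]; rfl
      rw [hV0, sub_zero]
      exact abs_inactive_scale_mul_le hN hτ hl hgj
  have hmeas : MeasurableSet {W : Rows m d | ∀ j k, |W j k - V j k| ≤ 1 / N} := by
    simp only [Set.ofPred_forall]
    exact MeasurableSet.iInter fun j => MeasurableSet.iInter fun k =>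
      measurableSet_le (by fun_prop) (by fun_prop)
  have hl_ge : ((1 / N) ^ 18) ^ s / 2 ≤ ∏ j, halfCauchy.real (Il j) := by
    refine sparse_prod_ge (A := A) (r := 1 / (2 * N)) (pow_nonneg hinv0 _)
      (pow_le_one₀ hinv0 hinv1) (by positivity)
      ((div_le_one (by positivity)).2 (by linarith)) hA ?_ (fun j hj => ?_) fun j hj => ?_
    · rw [mul_one_div, div_le_div_iff₀ (by positivity) (by norm_num)]; linarith
    · simp only [Il, if_pos hj]
      exact halfCauchy_real_local_scale_ge hN
    · simp only [Il, if_neg hj]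
      exact halfCauchy_real_Icc_zero_ge (by positivity)
  have hg_ge : (((1 / N) ^ 9) ^ d) ^ s / 2 ≤
      ∏ j, (Measure.pi fun _ : Fin d => gaussianReal 0 1).real (Set.univ.pi (Ig j)) := by
    have hN3 : 1 ≤ N ^ 2 := one_le_pow₀ (by linarith)
    have hN3' : N ≤ N ^ 3 := by nlinarith
    refine sparse_prod_ge (A := A) (r := 1 / (4 * N ^ 3)) (pow_nonneg (pow_nonneg hinv0 _) _)
      (pow_le_one₀ (pow_nonneg hinv0 _) (pow_le_one₀ hinv0 hinv1)) (by positivity)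
      ((div_le_one (by positivity)).2 (by linarith)) hA ?_ (fun j hj => ?_) fun j hj => ?_
    · rw [mul_one_div, div_le_div_iff₀ (by positivity) (by norm_num)]
      linarith
    · rw [measureReal_pi_pi]
      refine le_trans (le_of_eq ?_) (Finset.prod_le_prod (f := fun _ => (1 / N) ^ 9)
        (fun _ _ => pow_nonneg hinv0 _) fun k _ => ?_)
      · simp
      · simp only [Ig, if_pos hj]
        exact gaussianReal_real_active_ge hN (hV j k)
    · rw [measureReal_pi_pi]
      simp only [Ig, if_neg hj]
      exact gaussianReal_real_inactive_prod_ge hN hdN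
  have hhalf : 1 / N ≤ 1 / 2 := one_div_le_one_div_of_le (by norm_num) hN
  -- Budget in powers of `1/N`: 16 for `τ`, 18 per active `λ_j`, 9 per active Gaussian coordinate,
  -- and one for each of the two factors `1/2`.
  have hexp : 16 + ((18 * s + 1) + (9 * d * s + 1)) ≤ 27 * (1 + s) * d := by
    nlinarith [Nat.mul_le_mul_left s hd]
  rw [horseshoe, map_measureReal_apply (by fun_prop) hmeas]
  refine le_trans ?_ (measureReal_mono hsub)
  rw [measureReal_prod_prod, measureReal_prod_prod, measureReal_pi_pi, measureReal_pi_pi]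
  refine (pow_le_pow_of_le_one hinv0 hinv1 hexp).trans ?_
  have hsplit : (1 / N) ^ (16 + ((18 * s + 1) + (9 * d * s + 1))) =
      (1 / N) ^ 16 * ((((1 / N) ^ 18) ^ s * (1 / N)) * ((((1 / N) ^ 9) ^ d) ^ s * (1 / N))) := by
    rw [← pow_mul, ← pow_mul, ← pow_mul]; ring
  rw [hsplit]
  have h1 := halfCauchy_real_global_scale_ge hN
  generalize 1 / N = q at *
  have hq1 : (q ^ 18) ^ s * q ≤ (q ^ 18) ^ s / 2 := by
    rw [div_eq_mul_one_div]; gcongr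
  have hq2 : ((q ^ 9) ^ d) ^ s * q ≤ ((q ^ 9) ^ d) ^ s / 2 := by
    rw [div_eq_mul_one_div]; gcongr
  exact mul_le_mul h1 (mul_le_mul (hq1.trans hl_ge) (hq2.trans hg_ge) (by positivity)
    (by positivity)) (by positivity) (by positivity)

/-! ### Prior mass of neighbourhoods of the true latent positions -/

lemma frobSq_nonneg {m d : ℕ} (A : Rows m d) : 0 ≤ frobSq A :=
  Finset.sum_nonneg fun _ _ => Finset.sum_nonneg fun _ _ => sq_nonneg _

lemma frobSq_add_le {m d : ℕ} (A B : Rows m d) : frobSq (A + B) ≤ 2 * (frobSq A + frobSq B) := by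
  simp only [frobSq, ← Finset.sum_add_distrib, Finset.mul_sum]
  refine Finset.sum_le_sum fun j _ => Finset.sum_le_sum fun k _ => ?_
  simp only [Pi.add_apply]
  nlinarith [sq_nonneg (A j k - B j k)]

lemma frobSq_le_of_abs_le {m d : ℕ} {A : Rows m d} {r : ℝ} (h : ∀ j k, |A j k| ≤ r) :
    frobSq A ≤ m * d * r ^ 2 := by
  calc frobSq A ≤ ∑ _j : Fin m, ∑ _k : Fin d, r ^ 2 :=
        Finset.sum_le_sum fun j _ => Finset.sum_le_sum fun k _ => by
          rw [← sq_abs]; exact pow_le_pow_left₀ (abs_nonneg _) (h j k) 2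
    _ = _ := by simp [mul_assoc]

lemma row_sq_le_frobSq {m d : ℕ} (A : Rows m d) (j : Fin m) : ∑ k, A j k ^ 2 ≤ frobSq A :=
  Finset.single_le_sum (f := fun j => ∑ k, A j k ^ 2)
    (fun _ _ => Finset.sum_nonneg fun _ _ => sq_nonneg _) (Finset.mem_univ j)

lemma sq_le_frobSq {m d : ℕ} (A : Rows m d) (j : Fin m) (k : Fin d) : A j k ^ 2 ≤ frobSq A :=
  (Finset.single_le_sum (f := fun k => A j k ^ 2) (fun _ _ => sq_nonneg _)
    (Finset.mem_univ k)).trans (row_sq_le_frobSq A j)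

lemma abs_le_of_frobSq_le {m d : ℕ} {A : Rows m d} {r : ℝ} (hr : 0 ≤ r) (h : frobSq A ≤ r ^ 2)
    (j : Fin m) (k : Fin d) : |A j k| ≤ r :=
  abs_le_of_sq_le_sq ((sq_le_frobSq A j k).trans h) hr

lemma frobSq_smul {m d : ℕ} (c : ℝ) (A : Rows m d) : frobSq (c • A) = c ^ 2 * frobSq A := by
  simp only [frobSq, Pi.smul_apply, smul_eq_mul, mul_pow, Finset.mul_sum]

lemma groupNorm_smul {m d : ℕ} {c : ℝ} (hc : 0 ≤ c) (A : Rows m d) :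
    groupNorm (c • A) = c * groupNorm A := by
  simp only [groupNorm, Pi.smul_apply, smul_eq_mul, mul_pow, ← Finset.mul_sum]
  simp_rw [Real.sqrt_mul (sq_nonneg c), Real.sqrt_sq hc, Finset.mul_sum]

lemma groupNorm_nonneg {m d : ℕ} (A : Rows m d) : 0 ≤ groupNorm A :=
  Finset.sum_nonneg fun _ _ => Real.sqrt_nonneg _

lemma covariateMap_smul {n p d : ℕ} (Z : Rows n p) (c : ℝ) (B : Rows p d) :
    covariateMap Z (c • B) = c • covariateMap Z B := by
  ext i k
  simp only [covariateMap, Pi.smul_apply, smul_eq_mul, Finset.mul_sum]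
  exact Finset.sum_congr rfl fun _ _ => by ring

lemma covariateMap_sub {n p d : ℕ} (Z : Rows n p) (A B : Rows p d) :
    covariateMap Z (A - B) = covariateMap Z A - covariateMap Z B := by
  ext i k
  simp only [covariateMap, Pi.sub_apply, mul_sub, Finset.sum_sub_distrib]

lemma measurable_covariateMap {n p d : ℕ} (Z : Rows n p) :
    Measurable (covariateMap Z : Rows p d → Rows n d) := by
  unfold covariateMap
  fun_prop

/-- A quadratic bound for the covariate map on a ball of the group norm extends by homogeneity. -/
lemma frobSq_covariateMap_le_of_ball {n p d : ℕ} {Z : Rows n p} {r K : ℝ} (hr : 0 < r)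
    (h : ∀ B : Rows p d, groupNorm B ≤ r → frobSq (covariateMap Z B) ≤ K * frobSq B)
    (B : Rows p d) : frobSq (covariateMap Z B) ≤ K * frobSq B := by
  have hg := groupNorm_nonneg B
  have hc : 0 < r / (groupNorm B + 1) := by positivity
  have h1 := h ((r / (groupNorm B + 1)) • B) (by
    rw [groupNorm_smul hc.le, div_mul_eq_mul_div, div_le_iff₀ (by positivity)]
    nlinarith)
  rw [covariateMap_smul, frobSq_smul, frobSq_smul] at h1
  have h2 : 0 < (r / (groupNorm B + 1)) ^ 2 := by positivity
  nlinarith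

lemma measurable_frobSq_sub {n d : ℕ} (Xs : Rows n d) :
    Measurable fun x : Rows n d => frobSq (x - Xs) := by
  unfold frobSq
  simp only [Pi.sub_apply]
  fun_prop

instance (m d : ℕ) : IsProbabilityMeasure (horseshoe m d) :=
  Measure.isProbabilityMeasure_map (by fun_prop)

lemma measurable_covariateMap_add {n p d : ℕ} (Z : Rows n p) :
    Measurable fun w : Rows p d × Rows n d => covariateMap Z w.1 + w.2 :=
  ((measurable_covariateMap Z).comp measurable_fst).add measurable_snd

instance {n p d : ℕ} (Z : Rows n p) : IsProbabilityMeasure (latentPrior d Z) :=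
  Measure.isProbabilityMeasure_map (measurable_covariateMap_add Z).aemeasurable

/-- Both `B*` and the residual `X* - ZB*` are sparse, and their horseshoe laws are independent, so
the two small-ball bounds multiply. The quadratic bound on `Z` transfers the error in `B` to the
positions. -/
lemma latentPrior_small_ball {n p d sb sx : ℕ} (Z : Rows n p) (Bs : Rows p d) (Xs : Rows n d)
    {N K : ℝ} (hN : 2 ≤ N) (hd : 1 ≤ d) (hnN : (n : ℝ) ≤ N) (hpN : (p : ℝ) ≤ N)
    (hdN : (d : ℝ) ≤ N) (hB : ∀ j k, |Bs j k| ≤ N)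
    (hX : ∀ i k, |Xs i k - covariateMap Z Bs i k| ≤ N) (hsb : {j | Bs j ≠ 0}.ncard ≤ sb)
    (hsx : {i | Xs i ≠ covariateMap Z Bs i}.ncard ≤ sx) (hK₀ : 0 ≤ K)
    (hK : ∀ B : Rows p d, frobSq (covariateMap Z B) ≤ K * frobSq B) :
    (1 / N) ^ (27 * (2 + sb + sx) * d) ≤ (latentPrior d Z).real
      {x | frobSq (x - Xs) ≤ 2 * (K * p + n) * d / N ^ 2} := by
  have h1 := horseshoe_small_ball Bs hN hd hpN hdN hB hsb
  have h2 := horseshoe_small_ball (Xs - covariateMap Z Bs) (s := sx) hN hd hnN hdN hX (by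
    simpa [sub_eq_zero] using hsx)
  have hmeas : MeasurableSet {x : Rows n d | frobSq (x - Xs) ≤ 2 * (K * p + n) * d / N ^ 2} :=
    measurableSet_le (measurable_frobSq_sub Xs) measurable_const
  rw [latentPrior, map_measureReal_apply (measurable_covariateMap_add Z) hmeas]
  have hsub : {V : Rows p d | ∀ j k, |V j k - Bs j k| ≤ 1 / N} ×ˢ
      {W : Rows n d | ∀ j k, |W j k - (Xs - covariateMap Z Bs) j k| ≤ 1 / N} ⊆
      (fun w : Rows p d × Rows n d => covariateMap Z w.1 + w.2) ⁻¹'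
        {x | frobSq (x - Xs) ≤ 2 * (K * p + n) * d / N ^ 2} := by
    rintro ⟨V, W⟩ ⟨hV, hW⟩
    have e : covariateMap Z V + W - Xs =
        covariateMap Z (V - Bs) + (W - (Xs - covariateMap Z Bs)) := by
      rw [covariateMap_sub]; abel
    show frobSq (covariateMap Z V + W - Xs) ≤ _
    rw [e]
    have hV' : frobSq (V - Bs) ≤ p * d * (1 / N) ^ 2 := frobSq_le_of_abs_le hV
    have hW' : frobSq (W - (Xs - covariateMap Z Bs)) ≤ n * d * (1 / N) ^ 2 :=
      frobSq_le_of_abs_le hW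
    calc _ ≤ 2 * (frobSq (covariateMap Z (V - Bs)) + frobSq (W - (Xs - covariateMap Z Bs))) :=
          frobSq_add_le _ _
      _ ≤ 2 * (K * (p * d * (1 / N) ^ 2) + n * d * (1 / N) ^ 2) := by
          gcongr
          exact (hK _).trans (by gcongr)
      _ = _ := by rw [one_div_pow]; ring
  refine le_trans ?_ (measureReal_mono hsub)
  rw [measureReal_prod_prod]
  calc (1 / N) ^ (27 * (2 + sb + sx) * d)
      = (1 / N) ^ (27 * (1 + sb) * d) * (1 / N) ^ (27 * (1 + sx) * d) := by
        rw [← pow_add]; congr 1; ring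
    _ ≤ _ := mul_le_mul h1 h2 (by positivity) measureReal_nonneg

/-! ### Geometry of the latent space model -/

lemma sq_dotProduct_le {d : ℕ} (u v : Fin d → ℝ) :
    (u ⬝ᵥ v) ^ 2 ≤ (∑ k, u k ^ 2) * ∑ k, v k ^ 2 :=
  Finset.sum_mul_sq_le_sq_mul_sq _ _ _

lemma abs_dotProduct_le {d : ℕ} {u v : Fin d → ℝ} {R : ℝ} (hu : √(∑ k, u k ^ 2) ≤ R)
    (hv : √(∑ k, v k ^ 2) ≤ R) : |u ⬝ᵥ v| ≤ R ^ 2 := by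
  have hR : 0 ≤ R := (Real.sqrt_nonneg _).trans hu
  refine abs_le_of_sq_le_sq ?_ (by positivity)
  refine (sq_dotProduct_le u v).trans ?_
  rw [sq (R ^ 2)]
  exact mul_le_mul ((Real.sqrt_le_left hR).1 hu) ((Real.sqrt_le_left hR).1 hv)
    (Finset.sum_nonneg fun _ _ => sq_nonneg _) (by positivity)

lemma sum_sq_dotProduct_sub_le {n d : ℕ} {x xs : Rows n d} {R : ℝ}
    (hx : ∀ i, √(∑ k, x i k ^ 2) ≤ R) (hxs : ∀ i, √(∑ k, xs i k ^ 2) ≤ R) :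
    ∑ i, ∑ j, (x i ⬝ᵥ x j - xs i ⬝ᵥ xs j) ^ 2 ≤ 4 * n * R ^ 2 * frobSq (x - xs) := by
  have hbound : ∀ {v : Fin d → ℝ}, √(∑ k, v k ^ 2) ≤ R → ∑ k, v k ^ 2 ≤ R ^ 2 := fun hv =>
    (Real.sqrt_le_left ((Real.sqrt_nonneg _).trans hv)).1 hv
  have hpt : ∀ i j, (x i ⬝ᵥ x j - xs i ⬝ᵥ xs j) ^ 2 ≤
      2 * R ^ 2 * (∑ k, (x - xs) i k ^ 2) + 2 * R ^ 2 * ∑ k, (x - xs) j k ^ 2 := by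
    intro i j
    have e : x i ⬝ᵥ x j - xs i ⬝ᵥ xs j = (x - xs) i ⬝ᵥ x j + xs i ⬝ᵥ (x - xs) j := by
      simp only [Pi.sub_apply, sub_dotProduct, dotProduct_sub]; ring
    have h1 := sq_dotProduct_le ((x - xs) i) (x j)
    have h2 := sq_dotProduct_le (xs i) ((x - xs) j)
    have h0 : ∀ i, 0 ≤ ∑ k, (x - xs) i k ^ 2 := fun i => Finset.sum_nonneg fun _ _ => sq_nonneg _
    have h3 := mul_le_mul_of_nonneg_left (hbound (hx j)) (h0 i)
    have h4 := mul_le_mul_of_nonneg_right (hbound (hxs i)) (h0 j)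
    rw [e]
    nlinarith [sq_nonneg ((x - xs) i ⬝ᵥ x j - xs i ⬝ᵥ (x - xs) j)]
  refine (Finset.sum_le_sum fun i _ => Finset.sum_le_sum fun j _ => hpt i j).trans (le_of_eq ?_)
  simp only [Finset.sum_add_distrib, Finset.sum_const, Finset.card_univ, Fintype.card_fin,
    nsmul_eq_mul, ← Finset.mul_sum, frobSq]
  ring

lemma sum_dyad_eq {n : ℕ} (f : Fin n → Fin n → ℝ) :
    ∑ e : Dyad n, f e.1.1 e.1.2 = ∑ i, ∑ j, if i ≤ j then f i j else 0 := by
  rw [← Fintype.sum_prod_type' (f := fun i j => if i ≤ j then f i j else 0), ← Finset.sum_filter]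
  exact (Finset.sum_subtype _ (by simp) fun e : Fin n × Fin n => f e.1 e.2).symm

lemma sum_dyad_le {n : ℕ} {f : Fin n → Fin n → ℝ} (hf : ∀ i j, 0 ≤ f i j) :
    ∑ e : Dyad n, f e.1.1 e.1.2 ≤ ∑ i, ∑ j, f i j := by
  rw [sum_dyad_eq]
  refine Finset.sum_le_sum fun i _ => Finset.sum_le_sum fun j _ => ?_
  split_ifs
  · exact le_rfl
  · exact hf i j

lemma le_two_mul_sum_dyad {n : ℕ} {f : Fin n → Fin n → ℝ} (hf : ∀ i j, 0 ≤ f i j)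
    (hsymm : ∀ i j, f i j = f j i) : ∑ i, ∑ j, f i j ≤ 2 * ∑ e : Dyad n, f e.1.1 e.1.2 := by
  rw [sum_dyad_eq, two_mul]
  nth_rewrite 3 [Finset.sum_comm]
  simp only [← Finset.sum_add_distrib]
  refine Finset.sum_le_sum fun i _ => Finset.sum_le_sum fun j _ => ?_
  rcases le_total i j with h | h
  · rw [if_pos h]
    have : 0 ≤ if j ≤ i then f j i else 0 := by split_ifs <;> simp [hf]
    linarith
  · rw [if_pos h, hsymm j i]
    have : 0 ≤ if i ≤ j then f i j else 0 := by split_ifs <;> simp [hf]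
    linarith

lemma sum_sq_logOdds_sub_le {n d : ℕ} {x xs : Rows n d} {β βs R : ℝ}
    (hx : ∀ i, √(∑ k, x i k ^ 2) ≤ R) (hxs : ∀ i, √(∑ k, xs i k ^ 2) ≤ R) :
    ∑ e : Dyad n, (logOdds x β e - logOdds xs βs e) ^ 2 ≤
      2 * n ^ 2 * (β - βs) ^ 2 + 8 * n * R ^ 2 * frobSq (x - xs) := by
  refine (sum_dyad_le (f := fun i j => (β + x i ⬝ᵥ x j - (βs + xs i ⬝ᵥ xs j)) ^ 2)
    fun i j => sq_nonneg _).trans ?_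
  have h := sum_sq_dotProduct_sub_le hx hxs
  calc _ ≤ ∑ i, ∑ j, (2 * (β - βs) ^ 2 + 2 * (x i ⬝ᵥ x j - xs i ⬝ᵥ xs j) ^ 2) := by
        refine Finset.sum_le_sum fun i _ => Finset.sum_le_sum fun j _ => ?_
        nlinarith [sq_nonneg (β - βs - (x i ⬝ᵥ x j - xs i ⬝ᵥ xs j))]
    _ = 2 * n ^ 2 * (β - βs) ^ 2 + 2 * ∑ i, ∑ j, (x i ⬝ᵥ x j - xs i ⬝ᵥ xs j) ^ 2 := by
        simp only [Finset.sum_add_distrib, Finset.sum_const, Finset.card_univ, Fintype.card_fin,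
          nsmul_eq_mul, ← Finset.mul_sum]
        ring
    _ ≤ _ := by linarith

lemma mem_boundedRegion_of_frobSq_sub_le {n d : ℕ} {x xs : Rows n d} {C₁ R₁ C₅ R₅ C₆ r : ℝ}
    (hr : 0 ≤ r) (hxs : ∀ i k, |xs i k| ≤ C₁) (hxs' : ∀ i, √(∑ k, xs i k ^ 2) ≤ R₁)
    (hcenter : ∑ i, xs i = 0) (hC₅ : C₁ + r ≤ C₅) (hR₅ : R₁ + r ≤ R₅) (hC₆ : n * r ≤ C₆)
    (hx : frobSq (x - xs) ≤ r ^ 2) : x ∈ boundedRegion n d C₅ R₅ C₆ := by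
  have habs : ∀ i k, |x i k - xs i k| ≤ r := abs_le_of_frobSq_le hr hx
  refine ⟨fun i k => ?_, fun i => ?_, fun k => ?_⟩
  · have := abs_add_le (xs i k) (x i k - xs i k)
    rw [add_sub_cancel] at this
    linarith [habs i k, hxs i k]
  · have h1 := norm_add_le (WithLp.toLp 2 (xs i)) (WithLp.toLp 2 ((x - xs) i))
    rw [← WithLp.toLp_add, show xs i + (x - xs) i = x i by simp] at h1
    simp only [EuclideanSpace.norm_eq, Real.norm_eq_abs, sq_abs] at h1
    have h2 : √(∑ k, (x - xs) i k ^ 2) ≤ r :=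
      (Real.sqrt_le_left hr).2 ((row_sq_le_frobSq _ i).trans hx)
    linarith [hxs' i]
  · have h0 : ∑ i, xs i k = 0 := by
      have := congrFun hcenter k
      simpa using this
    have : ∑ i, x i k = ∑ i, (x i k - xs i k) := by rw [Finset.sum_sub_distrib, h0, sub_zero]
    rw [this]
    calc _ ≤ ∑ i, |x i k - xs i k| := Finset.abs_sum_le_sum_abs _ _
      _ ≤ ∑ _i : Fin n, r := Finset.sum_le_sum fun i _ => habs i k
      _ = n * r := by simp
      _ ≤ C₆ := hC₆

/-- The double sum equals `‖∑ x_i‖²`, because the truth is centred. This controls the cross term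
between the errors in `β` and in the Gram matrix. -/
lemma sum_dotProduct_sub_bounds {n d : ℕ} {x xs : Rows n d} {C₆ : ℝ} (hcenter : ∑ i, xs i = 0)
    (hx : ∀ k, |∑ i, x i k| ≤ C₆) :
    0 ≤ ∑ i, ∑ j, (x i ⬝ᵥ x j - xs i ⬝ᵥ xs j) ∧
      ∑ i, ∑ j, (x i ⬝ᵥ x j - xs i ⬝ᵥ xs j) ≤ d * C₆ ^ 2 := by
  have hexp : ∀ y : Rows n d, ∑ i, ∑ j, y i ⬝ᵥ y j = (∑ i, y i) ⬝ᵥ ∑ i, y i := fun y => by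
    simp_rw [sum_dotProduct, dotProduct_sum]
  have h0 : ∑ i, ∑ j, (x i ⬝ᵥ x j - xs i ⬝ᵥ xs j) = ∑ k, (∑ i, x i k) ^ 2 := by
    simp only [Finset.sum_sub_distrib]
    rw [hexp, hexp, hcenter, zero_dotProduct, sub_zero, dotProduct]
    refine Finset.sum_congr rfl fun k _ => ?_
    rw [Finset.sum_apply, sq]
  rw [h0]
  refine ⟨Finset.sum_nonneg fun _ _ => sq_nonneg _, ?_⟩
  calc ∑ k, (∑ i, x i k) ^ 2 ≤ ∑ _k : Fin d, C₆ ^ 2 := Finset.sum_le_sum fun k _ => by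
        rw [← sq_abs]; exact pow_le_pow_left₀ (abs_nonneg _) (hx k) 2
    _ = _ := by simp

/-- On the restricted parameter space, the truncated squared log-odds distance dominates the
loss. -/
lemma sum_min_sq_ge {n d : ℕ} {x xs : Rows n d} {β βs R₁ C₅ R₅ C₆ T : ℝ} (hn : 1 ≤ n)
    (hxs : ∀ i, √(∑ k, xs i k ^ 2) ≤ R₁) (hcenter : ∑ i, xs i = 0)
    (hx : x ∈ boundedRegion n d C₅ R₅ C₆) (hT₁ : T ≤ 1)
    (hdT : 8 * d ^ 2 * C₆ ^ 4 ≤ n ^ 4 * T) (hloss : T ≤ recoveryLoss x xs β βs) :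
    n ^ 2 * T / (4 * (2 * (R₁ ^ 2 + R₅ ^ 2) + 1) ^ 2) ≤
      ∑ i, ∑ j, min 1 ((β + x i ⬝ᵥ x j - (βs + xs i ⬝ᵥ xs j)) ^ 2) := by
  have hn0 : (0 : ℝ) < n := by exact_mod_cast hn
  obtain ⟨-, hxR, hxC⟩ := hx
  set L := R₁ ^ 2 + R₅ ^ 2 with hL
  have hL0 : 0 ≤ L := by positivity
  set Δ := β - βs with hΔ
  set δ : Fin n → Fin n → ℝ := fun i j => x i ⬝ᵥ x j - xs i ⬝ᵥ xs j with hδ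
  have hδL : ∀ i j, |δ i j| ≤ L := fun i j => by
    refine (abs_sub _ _).trans ?_
    linarith [abs_dotProduct_le (hxR i) (hxR j), abs_dotProduct_le (hxs i) (hxs j)]
  have ht : ∀ i j, β + x i ⬝ᵥ x j - (βs + xs i ⬝ᵥ xs j) = Δ + δ i j := fun i j => by
    simp only [hΔ, hδ]; ring
  simp_rw [ht]
  have hden : (1 : ℝ) ≤ 4 * (2 * L + 1) ^ 2 := by nlinarith
  -- A large error in `β` saturates every truncated term, and `T ≤ 1` suffices. Otherwise all
  -- differences are at most `2L + 1`, and truncation costs only a constant factor.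
  by_cases hbig : L + 1 ≤ |Δ|
  · have h1 : ∀ i j, min 1 ((Δ + δ i j) ^ 2) = 1 := fun i j => by
      refine min_eq_left ?_
      have h2 : |Δ| - |δ i j| ≤ |Δ + δ i j| := by
        have := abs_sub_abs_le_abs_sub Δ (-δ i j)
        rwa [abs_neg, sub_neg_eq_add] at this
      rw [← sq_abs]
      exact one_le_pow₀ (by linarith [hδL i j])
    simp_rw [h1]
    simp only [Finset.sum_const, Finset.card_univ, Fintype.card_fin, nsmul_eq_mul, mul_one]
    rw [div_le_iff₀ (by positivity)]
    nlinarith [mul_le_mul_of_nonneg_left hT₁ (sq_nonneg (n : ℝ)),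
      mul_le_mul_of_nonneg_left hden (sq_nonneg (n : ℝ))]
  · have h1 : ∀ i j, (Δ + δ i j) ^ 2 / (2 * L + 1) ^ 2 ≤ min 1 ((Δ + δ i j) ^ 2) := fun i j => by
      have h2 : |Δ + δ i j| ≤ 2 * L + 1 := by
        linarith [abs_add_le Δ (δ i j), hδL i j, not_le.1 hbig]
      refine le_min ((div_le_one (by positivity)).2 ?_) (div_le_self (sq_nonneg _) ?_)
      · rw [← sq_abs]; exact pow_le_pow_left₀ (abs_nonneg _) h2 2
      · exact one_le_pow₀ (by linarith)
    have hS : n ^ 2 * T / 4 ≤ ∑ i, ∑ j, (Δ + δ i j) ^ 2 := by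
      obtain ⟨hs0, hs1⟩ := sum_dotProduct_sub_bounds (d := d) hcenter hxC
      change 0 ≤ ∑ i, ∑ j, δ i j at hs0
      change ∑ i, ∑ j, δ i j ≤ d * C₆ ^ 2 at hs1
      have hexp : ∑ i, ∑ j, (Δ + δ i j) ^ 2 =
          n ^ 2 * Δ ^ 2 + 2 * Δ * (∑ i, ∑ j, δ i j) + ∑ i, ∑ j, δ i j ^ 2 := by
        simp only [add_sq, Finset.sum_add_distrib, Finset.sum_const, Finset.card_univ,
          Fintype.card_fin, nsmul_eq_mul, ← Finset.mul_sum]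
        ring
      have hloss' : n ^ 2 * T ≤ (∑ i, ∑ j, δ i j ^ 2) + n ^ 2 * Δ ^ 2 := by
        have := mul_le_mul_of_nonneg_left hloss (sq_nonneg (n : ℝ))
        rw [recoveryLoss, mul_add, ← mul_assoc, mul_one_div_cancel (by positivity), one_mul] at this
        exact this
      have hq : 0 ≤ ∑ i, ∑ j, δ i j ^ 2 :=
        Finset.sum_nonneg fun _ _ => Finset.sum_nonneg fun _ _ => sq_nonneg _
      rw [hexp]
      generalize (∑ i, ∑ j, δ i j) = S at *
      generalize (∑ i, ∑ j, δ i j ^ 2) = Q at *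
      have hS2 : 2 * S ^ 2 ≤ n ^ 2 * (n ^ 2 * T) / 4 := by
        have : S ^ 2 ≤ (d * C₆ ^ 2) ^ 2 := pow_le_pow_left₀ hs0 hs1 2
        nlinarith
      -- Completing the square spends half of `n²Δ²` on the cross term; the remainder `2S²/n²` is at
      -- most `n²T/4`.
      have hcross : n ^ 2 * (-(2 * Δ * S)) ≤ n ^ 2 * (n ^ 2 * Δ ^ 2 / 2 + n ^ 2 * T / 4) := by
        nlinarith [sq_nonneg (n ^ 2 * Δ + 2 * S)]
      have hcross' := le_of_mul_le_mul_left hcross (by positivity)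
      nlinarith
    calc n ^ 2 * T / (4 * (2 * L + 1) ^ 2) = n ^ 2 * T / 4 / (2 * L + 1) ^ 2 := by rw [div_div]
      _ ≤ (∑ i, ∑ j, (Δ + δ i j) ^ 2) / (2 * L + 1) ^ 2 := by gcongr
      _ = ∑ i, ∑ j, (Δ + δ i j) ^ 2 / (2 * L + 1) ^ 2 := by simp only [Finset.sum_div]
      _ ≤ _ := Finset.sum_le_sum fun i _ => Finset.sum_le_sum fun j _ => h1 i j

lemma sum_exp_mul_min_sq_ge {n d : ℕ} {x xs : Rows n d} {β βs R₁ C₅ R₅ C₆ T : ℝ} (hn : 1 ≤ n)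
    (hxs : ∀ i, √(∑ k, xs i k ^ 2) ≤ R₁) (hcenter : ∑ i, xs i = 0)
    (hx : x ∈ boundedRegion n d C₅ R₅ C₆) (hT₁ : T ≤ 1)
    (hdT : 8 * d ^ 2 * C₆ ^ 4 ≤ n ^ 4 * T) (hloss : T ≤ recoveryLoss x xs β βs) :
    Real.exp (-R₁ ^ 2) / (8 * (2 * (R₁ ^ 2 + R₅ ^ 2) + 1) ^ 2) * (Real.exp βs * (n ^ 2 * T)) ≤
      ∑ e : Dyad n, Real.exp (logOdds xs βs e) *
        min 1 ((logOdds x β e - logOdds xs βs e) ^ 2) := by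
  have h1 := sum_min_sq_ge hn hxs hcenter hx hT₁ hdT hloss
  have h2 := le_two_mul_sum_dyad
    (f := fun i j => min 1 ((β + x i ⬝ᵥ x j - (βs + xs i ⬝ᵥ xs j)) ^ 2))
    (fun i j => le_min zero_le_one (sq_nonneg _))
    (fun i j => by simp only [dotProduct_comm (x i) (x j), dotProduct_comm (xs i) (xs j)])
  have h3 : ∀ e : Dyad n, Real.exp (βs - R₁ ^ 2) *
      min 1 ((β + x e.1.1 ⬝ᵥ x e.1.2 - (βs + xs e.1.1 ⬝ᵥ xs e.1.2)) ^ 2) ≤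
      Real.exp (logOdds xs βs e) * min 1 ((logOdds x β e - logOdds xs βs e) ^ 2) := fun e => by
    refine mul_le_mul_of_nonneg_right (Real.exp_le_exp.2 ?_) (le_min zero_le_one (sq_nonneg _))
    have := (abs_le.1 (abs_dotProduct_le (hxs e.1.1) (hxs e.1.2))).1
    rw [logOdds]; linarith
  have h4 := Finset.sum_le_sum fun e (_ : e ∈ Finset.univ) => h3 e
  rw [← Finset.mul_sum] at h4
  refine le_trans ?_ h4
  have h5 := mul_le_mul_of_nonneg_left (h1.trans h2) (Real.exp_pos (βs - R₁ ^ 2)).le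
  have e1 : Real.exp (βs - R₁ ^ 2) = Real.exp βs * Real.exp (-R₁ ^ 2) := by
    rw [← Real.exp_add]; congr 1
  calc _ = Real.exp (βs - R₁ ^ 2) * (n ^ 2 * T / (4 * (2 * (R₁ ^ 2 + R₅ ^ 2) + 1) ^ 2)) / 2 := by
        rw [e1]; field_simp; ring
    _ ≤ _ := by linarith

/-! ### Prior mass in the restricted model -/

lemma measurableSet_boundedRegion (n d : ℕ) (C R C' : ℝ) :
    MeasurableSet (boundedRegion n d C R C') := by
  unfold boundedRegion
  simp only [Set.ofPred_and, Set.ofPred_forall]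
  refine MeasurableSet.inter ?_ (MeasurableSet.inter ?_ ?_)
  · exact MeasurableSet.iInter fun i => MeasurableSet.iInter fun k =>
      measurableSet_le (by fun_prop) measurable_const
  · exact MeasurableSet.iInter fun i => measurableSet_le (by fun_prop) measurable_const
  · exact MeasurableSet.iInter fun k => measurableSet_le (by fun_prop) measurable_const

/-- Conditioning divides by a mass at most one, so no estimate of the mass of the restricted region
is needed. -/
lemma le_cond_real_of_subset {Ω : Type*} [MeasurableSpace Ω] {μ : Measure Ω}
    [IsProbabilityMeasure μ] {S V : Set Ω} (hS : MeasurableSet S) (hVS : V ⊆ S) :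
    μ.real V ≤ (cond μ S).real V := by
  rw [measureReal_def (cond μ S), cond_apply hS, Set.inter_eq_right.2 hVS, ENNReal.toReal_mul,
    ENNReal.toReal_inv]
  change μ.real V ≤ (μ.real S)⁻¹ * μ.real V
  rcases eq_or_lt_of_le (measureReal_nonneg (μ := μ) (s := S)) with h | h
  · have : μ.real V ≤ μ.real S := measureReal_mono hVS
    rw [← h] at this ⊢
    simpa using this
  · exact le_mul_of_one_le_left measureReal_nonneg ((one_le_inv₀ h).2 measureReal_le_one)

lemma ae_restrictedPrior_mem {n p d : ℕ} (Z : Rows n p) {S : Set (Rows n d)}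
    (hS : MeasurableSet S) (priorβ : Measure ℝ) [SFinite priorβ] :
    ∀ᵐ θ ∂(restrictedPrior Z S priorβ), θ.1 ∈ S :=
  Measure.quasiMeasurePreserving_fst.ae (ae_cond_mem hS)

/-- The small-ball bound is applied with `N = a^(k+5)`, `a = np`. The entries of `ZB*` are at most
`a^(k+4)`, so the residual stays below `N`, and the resulting Frobenius ball has radius at most
`1/n²`. Its positive mass also makes the conditioning legitimate. -/
lemma restrictedPrior_mass_ge {n p d sb sx k : ℕ} (Z : Rows n p) (Bs : Rows p d) (Xs : Rows n d)
    (priorβ : Measure ℝ) [IsProbabilityMeasure priorβ] (βs ρ : ℝ) {K : ℝ} {S : Set (Rows n d)}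
    (hn : 2 ≤ n) (hp : 1 ≤ p) (hd : 1 ≤ d) (hdn : (d : ℝ) ≤ (n : ℝ) ^ 2) (hK₀ : 0 ≤ K)
    (hKn : K ≤ n) (hK : ∀ B : Rows p d, frobSq (covariateMap Z B) ≤ K * n * frobSq B)
    (hB : ∀ j l, |Bs j l| ≤ ((n : ℝ) * p) ^ (k + 1)) (hX : ∀ i l, |Xs i l| ≤ n)
    (hsb : {j | Bs j ≠ 0}.ncard ≤ sb) (hsx : {i | Xs i ≠ covariateMap Z Bs i}.ncard ≤ sx)
    (hS : MeasurableSet S) (hXS : ∀ x, frobSq (x - Xs) ≤ (1 / (n : ℝ) ^ 2) ^ 2 → x ∈ S) :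
    IsProbabilityMeasure (restrictedPrior Z S priorβ) ∧
      (1 / ((n : ℝ) * p) ^ (k + 5)) ^ (27 * (2 + sb + sx) * d) *
          priorβ.real {β | |β - βs| ≤ ρ} ≤
        (restrictedPrior Z S priorβ).real
          ({x | frobSq (x - Xs) ≤ (1 / (n : ℝ) ^ 2) ^ 2} ×ˢ {β | |β - βs| ≤ ρ}) := by
  have hn' : (2 : ℝ) ≤ n := by exact_mod_cast hn
  have hp' : (1 : ℝ) ≤ p := by exact_mod_cast hp
  have hn0 : (0 : ℝ) < n := by linarith
  set a : ℝ := n * p with ha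
  have hna : (n : ℝ) ≤ a := by rw [ha]; nlinarith
  have hpa : (p : ℝ) ≤ a := by rw [ha]; nlinarith
  have ha2 : 2 ≤ a := by linarith
  have ha1 : 1 ≤ a := by linarith
  have ha0 : 0 < a := by linarith
  have hmono : ∀ {i j : ℕ}, i ≤ j → a ^ i ≤ a ^ j := fun h => pow_le_pow_right₀ ha1 h
  have haN : a ≤ a ^ (k + 5) := by simpa using hmono (i := 1) (j := k + 5) (by omega)
  have hda : (d : ℝ) ≤ a ^ 2 := hdn.trans (by gcongr)
  have hfB : frobSq (covariateMap Z Bs) ≤ (a ^ (k + 4)) ^ 2 := by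
    calc _ ≤ K * n * frobSq Bs := hK Bs
      _ ≤ n * n * (p * d * (a ^ (k + 1)) ^ 2) :=
          mul_le_mul (by gcongr) (frobSq_le_of_abs_le hB) (frobSq_nonneg _) (by positivity)
      _ = n * (n * p) * d * a ^ (2 * k + 2) := by ring
      _ ≤ a * a * a ^ 2 * a ^ (2 * k + 2) := by gcongr
      _ = a ^ (2 * k + 6) := by ring
      _ ≤ a ^ (2 * k + 8) := hmono (by omega)
      _ = _ := by ring
  have hXZ : ∀ i l, |Xs i l - covariateMap Z Bs i l| ≤ a ^ (k + 5) := fun i l => by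
    have h1 := abs_le_of_frobSq_le (by positivity) hfB i l
    have h2 : a ≤ a ^ (k + 4) := by simpa using hmono (i := 1) (j := k + 4) (by omega)
    calc _ ≤ |Xs i l| + |covariateMap Z Bs i l| := abs_sub _ _
      _ ≤ a ^ (k + 4) + a ^ (k + 4) := by linarith [hX i l]
      _ = 2 * a ^ (k + 4) := by ring
      _ ≤ a * a ^ (k + 4) := by gcongr
      _ = _ := by ring
  have hball := latentPrior_small_ball Z Bs Xs (ha2.trans haN) hd (hna.trans haN) (hpa.trans haN)
    (hda.trans (hmono (by omega))) (fun j l => (hB j l).trans (hmono (by omega))) hXZ hsb hsx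
    (K := K * n) (by positivity) hK
  set V : Set (Rows n d) := {x | frobSq (x - Xs) ≤ (1 / (n : ℝ) ^ 2) ^ 2}
  have hsub : {x : Rows n d | frobSq (x - Xs) ≤ 2 * (K * n * p + n) * d / (a ^ (k + 5)) ^ 2} ⊆ V := by
    intro x hx
    refine (show frobSq (x - Xs) ≤ _ from hx).trans ?_
    rw [one_div_pow, div_le_div_iff₀ (by positivity) (by positivity), one_mul]
    calc 2 * (K * n * p + n) * d * ((n : ℝ) ^ 2) ^ 2
        ≤ 2 * (a * a + a) * a ^ 2 * (a ^ 2) ^ 2 := by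
          have : K * n * p ≤ a * a := by
            rw [mul_assoc, ← ha]; exact mul_le_mul_of_nonneg_right (hKn.trans hna) ha0.le
          gcongr
      _ ≤ 2 * (a * a + a * a) * a ^ 2 * (a ^ 2) ^ 2 := by
          gcongr; nlinarith
      _ = 2 ^ 2 * a ^ 8 := by ring
      _ ≤ a ^ 2 * a ^ 8 := by gcongr
      _ = a ^ 10 := by ring
      _ ≤ a ^ (2 * k + 10) := hmono (by omega)
      _ = _ := by ring
  have hV : (1 / a ^ (k + 5)) ^ (27 * (2 + sb + sx) * d) ≤ (cond (latentPrior d Z) S).real V :=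
    (hball.trans (measureReal_mono hsub)).trans (le_cond_real_of_subset hS hXS)
  have hS0 : latentPrior d Z S ≠ 0 := by
    have h1 : 0 < (latentPrior d Z).real S :=
      lt_of_lt_of_le (by positivity) ((hball.trans (measureReal_mono hsub)).trans
        (measureReal_mono hXS))
    intro h
    rw [measureReal_def, h] at h1
    simp at h1
  have := cond_isProbabilityMeasure hS0
  refine ⟨by unfold restrictedPrior; infer_instance, ?_⟩
  rw [restrictedPrior, measureReal_prod_prod]
  exact mul_le_mul_of_nonneg_right hV measureReal_nonneg

/-! ### The fixed-sample posterior bound -/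

lemma measurableSet_le_recoveryLoss {n d : ℕ} (xs : Rows n d) (βs T : ℝ) :
    MeasurableSet {θ : Rows n d × ℝ | T ≤ recoveryLoss θ.1 xs θ.2 βs} := by
  refine measurableSet_le measurable_const ?_
  unfold recoveryLoss dotProduct
  fun_prop

/-- The constant relating the loss to the exponent of the likelihood affinity. -/
noncomputable def affinityConst (α B R₁ R₅ : ℝ) : ℝ :=
  renyiConst α (B + R₁ ^ 2) * (Real.exp (-R₁ ^ 2) / (8 * (2 * (R₁ ^ 2 + R₅ ^ 2) + 1) ^ 2))

lemma affinityConst_pos {α : ℝ} (B R₁ R₅ : ℝ) (hα₀ : 0 < α) (hα₁ : α < 1) :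
    0 < affinityConst α B R₁ R₅ :=
  mul_pos (renyiConst_pos _ hα₀ hα₁) (by positivity)

lemma posterior_recoveryLoss_bound {n p d : ℕ} (Z : Rows n p) (Xs : Rows n d)
    (priorβ : Measure ℝ) [IsProbabilityMeasure priorβ] {βs ρ α B C₅ R₁ R₅ C₆ T m r k : ℝ}
    (hα₀ : 0 < α) (hα₁ : α < 1) (hn : 1 ≤ n) (hβB : βs ≤ B)
    (hXs : ∀ i, √(∑ l, Xs i l ^ 2) ≤ R₁) (hR : R₁ ≤ R₅) (hcenter : ∑ i, Xs i = 0)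
    (hT₁ : T ≤ 1) (hdT : 8 * d ^ 2 * C₆ ^ 4 ≤ n ^ 4 * T) (hm : 0 < m) (hk : 1 ≤ k)
    (hprob : IsProbabilityMeasure (restrictedPrior Z (boundedRegion n d C₅ R₅ C₆) priorβ))
    (hsub : ∀ x : Rows n d, frobSq (x - Xs) ≤ r ^ 2 → x ∈ boundedRegion n d C₅ R₅ C₆)
    (hmass : m ≤ (restrictedPrior Z (boundedRegion n d C₅ R₅ C₆) priorβ).real
      ({x | frobSq (x - Xs) ≤ r ^ 2} ×ˢ {β | |β - βs| ≤ ρ})) :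
    1 - 2 / k ≤ (networkLaw Xs βs).real
      {Y | fractionalPosterior (restrictedPrior Z (boundedRegion n d C₅ R₅ C₆) priorβ) α Y
          {θ | T ≤ recoveryLoss θ.1 Xs θ.2 βs} ≤
        ENNReal.ofReal (4 * Real.exp (-(affinityConst α B R₁ R₅ * (Real.exp βs * (n ^ 2 * T)))) *
          Real.exp (n ^ 2 * ρ ^ 2 + 4 * n * R₅ ^ 2 * r ^ 2) * k ^ 2 / m)} := by
  refine fractionalPosterior_le_with_high_probability _ hα₀ hα₁ Xs βs
    (measurableSet_le_recoveryLoss Xs βs T)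
    (MeasurableSet.prod (measurableSet_le (measurable_frobSq_sub Xs) measurable_const)
      (measurableSet_le (by fun_prop) measurable_const))
    (Real.exp_pos _) (Real.one_le_exp (by positivity)) hm hk ?_ ?_ hmass
  · filter_upwards [ae_restrictedPrior_mem Z (measurableSet_boundedRegion n d C₅ R₅ C₆) priorβ]
      with θ hθ hloss
    have hlo : ∀ e : Dyad n, logOdds Xs βs e ≤ B + R₁ ^ 2 := fun e => by
      have := (abs_le.1 (abs_dotProduct_le (hXs e.1.1) (hXs e.1.2))).2
      rw [logOdds]; linarith
    refine (sum_likelihood_rpow_le hα₀ hα₁ θ.1 Xs θ.2 βs hlo).trans (Real.exp_le_exp.2 ?_)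
    have h := mul_le_mul_of_nonneg_left
      (sum_exp_mul_min_sq_ge hn hXs hcenter hθ hT₁ hdT hloss)
      (renyiConst_pos (B + R₁ ^ 2) hα₀ hα₁).le
    rw [affinityConst, mul_assoc]
    linarith
  · rintro ⟨x, β⟩ ⟨hx, hβ⟩
    refine (sum_likelihood_sq_div_le x Xs β βs).trans (Real.exp_le_exp.2 ?_)
    have h := sum_sq_logOdds_sub_le (β := β) (βs := βs) (hsub x hx).2.1
      fun i => (hXs i).trans hR
    have h1 : (β - βs) ^ 2 ≤ ρ ^ 2 := by
      rw [← sq_abs]; exact pow_le_pow_left₀ (abs_nonneg _) hβ 2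
    have h2 : 2 * (n : ℝ) ^ 2 * (β - βs) ^ 2 ≤ 2 * (n : ℝ) ^ 2 * ρ ^ 2 := by gcongr
    have h3 : 8 * (n : ℝ) * R₅ ^ 2 * frobSq (x - Xs) ≤ 8 * n * R₅ ^ 2 * r ^ 2 := by
      gcongr; exact hx
    linarith

/-! ### Asymptotics -/

lemma sq_mul_epsRate_sq {M₀ : ℝ} {n p d sb sx : ℕ} (hn : 1 ≤ n) (hp : 1 ≤ p) :
    (n : ℝ) ^ 2 * epsRate M₀ n p d sb sx ^ 2 =
      M₀ ^ 2 * ((1 + sb + sx) * d * Real.log (n * p)) := by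
  have hn' : (1 : ℝ) ≤ n := by exact_mod_cast hn
  have hp' : (1 : ℝ) ≤ p := by exact_mod_cast hp
  have hlog : 0 ≤ Real.log (n * p) := Real.log_nonneg (by nlinarith)
  rw [epsRate, mul_pow, Real.sq_sqrt (by positivity)]
  field_simp

lemma log_le_sq_mul_epsRate_sq {M₀ : ℝ} {n p d sb sx : ℕ} (hn : 1 ≤ n) (hp : 1 ≤ p) :
    M₀ ^ 2 * (d * Real.log n) ≤ (n : ℝ) ^ 2 * epsRate M₀ n p d sb sx ^ 2 := by
  have hn' : (1 : ℝ) ≤ n := by exact_mod_cast hn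
  have hp' : (1 : ℝ) ≤ p := by exact_mod_cast hp
  rw [sq_mul_epsRate_sq hn hp]
  have h1 : Real.log n ≤ Real.log (n * p) := Real.log_le_log (by linarith) (by nlinarith)
  have h0 : 0 ≤ Real.log n := Real.log_nonneg hn'
  gcongr
  refine le_mul_of_one_le_left (by positivity) ?_
  have : (0 : ℝ) ≤ sb := by positivity
  have : (0 : ℝ) ≤ sx := by positivity
  linarith

/-- The exponent times `log(np)` is a multiple of `n²ε²`; here `54 = 2 · 27`, from `2 + s_b + s_x ≤
2(1 + s_b + s_x)`. -/
lemma exp_neg_le_pow_of_rate {M₀ : ℝ} {n p d sb sx k : ℕ} (hM₀ : 0 < M₀) (hn : 1 ≤ n)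
    (hp : 1 ≤ p) :
    Real.exp (-(54 * k / M₀ ^ 2 * ((n : ℝ) ^ 2 * epsRate M₀ n p d sb sx ^ 2))) ≤
      (1 / ((n : ℝ) * p) ^ k) ^ (27 * (2 + sb + sx) * d) := by
  have hn' : (1 : ℝ) ≤ n := by exact_mod_cast hn
  have hp' : (1 : ℝ) ≤ p := by exact_mod_cast hp
  have ha : 0 < (n : ℝ) * p := by positivity
  have hlog : 0 ≤ Real.log (n * p) := Real.log_nonneg (by nlinarith)
  have h1 : (1 / ((n : ℝ) * p) ^ k) ^ (27 * (2 + sb + sx) * d) =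
      Real.exp (-((k * (27 * (2 + sb + sx) * d) : ℕ) * Real.log (n * p))) := by
    rw [Real.exp_neg, Real.exp_nat_mul, Real.exp_log ha, one_div, inv_pow, ← pow_mul]
  rw [h1, sq_mul_epsRate_sq hn hp]
  refine Real.exp_le_exp.2 (neg_le_neg ?_)
  have h2 : 54 * k / M₀ ^ 2 * (M₀ ^ 2 * ((1 + sb + sx) * d * Real.log (n * p))) =
      k * (27 * (2 * (1 + sb + sx)) * d) * Real.log (n * p) := by
    field_simp; ring
  rw [h2]
  push_cast
  have : (0 : ℝ) ≤ sb := by positivity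
  have : (0 : ℝ) ≤ sx := by positivity
  gcongr
  linarith

lemma const_mul_rpow_le_pow {K c : ℝ} {n p : ℕ} (hn : 1 ≤ n) (hp : 1 ≤ p) (hK : |K| ≤ n) :
    K * (p : ℝ) ^ c ≤ ((n : ℝ) * p) ^ (⌈|c|⌉₊ + 1) := by
  have hn' : (1 : ℝ) ≤ n := by exact_mod_cast hn
  have hp' : (1 : ℝ) ≤ p := by exact_mod_cast hp
  have h1 : (p : ℝ) ^ c ≤ (p : ℝ) ^ ⌈|c|⌉₊ := by
    rw [← Real.rpow_natCast]
    exact Real.rpow_le_rpow_of_exponent_le hp' ((le_abs_self c).trans (Nat.le_ceil _))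
  have h2 : (p : ℝ) ≤ n * p := by nlinarith
  have h3 : (n : ℝ) ≤ n * p := by nlinarith
  calc K * (p : ℝ) ^ c ≤ n * (p : ℝ) ^ ⌈|c|⌉₊ :=
        mul_le_mul ((le_abs_self K).trans hK) h1 (by positivity) (by positivity)
    _ ≤ (n * p) * (n * p) ^ ⌈|c|⌉₊ := by gcongr
    _ = _ := by ring

set_option maxHeartbeats 1000000 in
theorem corollary1
    -- dimensions, sparsity bounds, covariates, true parameters and priors on `β`, indexed by `n`
    (d p sb sx : ℕ → ℕ)
    (Z : (n : ℕ) → Rows n (p n)) (Xs : (n : ℕ) → Rows n (d n)) (Bs : (n : ℕ) → Rows (p n) (d n))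
    (βs : ℕ → ℝ) (priorβ : ℕ → Measure ℝ) [∀ n, IsProbabilityMeasure (priorβ n)]
    (hd : ∀ n, 1 ≤ d n) (hp : ∀ n, 1 ≤ p n)
    -- sparsity of the truth
    (hsx : ∀ n, {i | Xs n i ≠ covariateMap (Z n) (Bs n) i}.ncard ≤ sx n)
    (hsb : ∀ n, {j | Bs n j ≠ 0}.ncard ≤ sb n)
    -- magnitude of the true parameters
    (C₁ R₁ C₂ K₂ : ℝ)
    (hX_sup : ∀ n i k, |Xs n i k| ≤ C₁)
    (hX_two : ∀ n i, √(∑ k, Xs n i k ^ 2) ≤ R₁)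
    (hB : ∀ᶠ n in atTop, ∀ j k, |Bs n j k| ≤ K₂ * (p n : ℝ) ^ C₂)
    -- restricted eigenvalue bound
    (cbar c₀ : ℝ) (hc₀ : 0 < c₀)
    (hZ : ∀ᶠ n in atTop, ∀ B : Rows (p n) (d n),
      groupNorm B ≤ c₀ * (max 1 (sb n) : ℕ) * d n * Real.log (n * p n) →
        frobSq (covariateMap (Z n) B) ≤ cbar * n * frobSq B)
    -- rate and sparsity level of the network
    (M₀ : ℝ) (hM₀ : 0 < M₀) (ε : ℕ → ℝ)
    (hε_def : ∀ n, ε n = epsRate M₀ n (p n) (d n) (sb n) (sx n))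
    (hε : Tendsto ε atTop (𝓝 0))
    (hlogp : (fun n => Real.log (p n)) =O[atTop] fun n : ℕ => Real.log n)
    (hβs_sparse : Tendsto (fun n => ε n ^ 2 / Real.exp (βs n)) atTop (𝓝 0))
    (hβs_bdd : BddAbove (Set.range βs))
    -- prior mass for the sparsity parameter
    (c₄ κ : ℝ) (hc₄ : 0 < c₄) (hκ : 0 < κ)
    (hprior : ∀ᶠ n : ℕ in atTop,
      κ * Real.exp (-((n : ℝ) ^ 2 * ε n ^ 2)) ≤ (priorβ n).real {β | |β - βs n| ≤ c₄ * ε n})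
    -- identifiability
    (hcenter : ∀ n, ∑ i, Xs n i = 0)
    -- restriction of the prior
    (C₅ R₅ C₆ : ℝ) (hC₅ : C₁ < C₅) (hR₅ : R₁ < R₅) (hC₆ : 0 < C₆)
    -- fractional power
    (α : ℝ) (hα₀ : 0 < α) (hα₁ : α < 1) :
    ∃ Mmin : ℝ, 0 < Mmin ∧ ∀ M : ℝ, Mmin ≤ M → ∀ D : ℝ, 2 ≤ D → ∀ η : ℝ, 0 < η →
      ∀ᶠ n : ℕ in atTop,
        1 - 2 / ((D - 1 + η) ^ 2 * (n : ℝ) ^ 2 * ε n ^ 2) ≤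
          (networkLaw (Xs n) (βs n)).real
            {Y | fractionalPosterior
                (restrictedPrior (Z n) (boundedRegion n (d n) C₅ R₅ C₆) (priorβ n)) α Y
                {θ | M * ((D + 3 * η) / (1 - α)) * Real.exp (-βs n) * ε n ^ 2 ≤
                  recoveryLoss θ.1 (Xs n) θ.2 (βs n)} ≤
              ENNReal.ofReal (Real.exp (-(η * (n : ℝ) ^ 2 * ε n ^ 2)))} := by
  have hlog : Tendsto (fun n : ℕ => Real.log n) atTop atTop :=
    Real.tendsto_log_atTop.comp tendsto_natCast_atTop_atTop
  have hcast : Tendsto (fun n : ℕ => (n : ℝ)) atTop atTop := tendsto_natCast_atTop_atTop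
  have hinv : Tendsto (fun n : ℕ => 1 / (n : ℝ)) atTop (𝓝 0) := tendsto_one_div_atTop_nhds_zero_nat
  obtain ⟨B, hB'⟩ := hβs_bdd
  have hβB : ∀ n, βs n ≤ B := fun n => hB' ⟨n, rfl⟩
  have hM₀2 : 0 < M₀ ^ 2 := by positivity
  have hEtop : Tendsto (fun n : ℕ => (n : ℝ) ^ 2 * ε n ^ 2) atTop atTop := by
    refine tendsto_atTop_mono' _ ?_ (hlog.const_mul_atTop hM₀2)
    filter_upwards [eventually_ge_atTop 1] with n hn
    rw [hε_def]
    refine le_trans ?_ (log_le_sq_mul_epsRate_sq hn (hp n))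
    have h1 : (1 : ℝ) ≤ d n := by exact_mod_cast hd n
    have h2 : 0 ≤ Real.log n := Real.log_nonneg (by exact_mod_cast hn)
    gcongr
    exact le_mul_of_one_le_left h2 h1
  set kk := ⌈|C₂|⌉₊ with hkk
  set c := affinityConst α B R₁ R₅ with hc
  have hc0 : 0 < c := affinityConst_pos B R₁ R₅ hα₀ hα₁
  set b' := c₄ ^ 2 + 4 * R₅ ^ 2 with hb'
  set m' : ℝ := 54 * (kk + 5 : ℕ) / M₀ ^ 2 + 2 with hm'
  have hb'0 : 0 ≤ b' := by positivity
  have hm'0 : 0 ≤ m' := by positivity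
  -- Here `b'` bounds the second-moment exponent and `m'` the prior-mass exponent per unit of `E`.
  -- The 5 covers the factor 4, the square of `k = e^E`, and a surplus that yields `η`.
  refine ⟨(b' + m' + 5) / c, by positivity, fun M hM D hD η hη => ?_⟩
  have hcM : b' + m' + 5 ≤ c * M := by
    rw [div_le_iff₀ hc0] at hM; linarith
  have hM0 : 0 < M := lt_of_lt_of_le (by positivity) hM
  have h1α : 0 < 1 - α := by linarith
  set q := (D + 3 * η) / (1 - α) with hq
  have hDq : D + 3 * η ≤ q := by
    rw [hq, le_div_iff₀ h1α]
    exact mul_le_of_le_one_right (by linarith) (by linarith)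
  have hq1 : 1 ≤ q := by linarith
  -- Since `ε → 0` and `ε²` is at least `M₀² d log n / n²`, the dimension cannot exceed `n²`
  -- eventually.
  have hd_le : ∀ᶠ n : ℕ in atTop, (d n : ℝ) ≤ (n : ℝ) ^ 2 := by
    have hε2 : Tendsto (fun n => ε n ^ 2) atTop (𝓝 0) := by simpa using hε.pow 2
    filter_upwards [hε2.eventually_le_const hM₀2, hlog.eventually_ge_atTop 1,
      eventually_ge_atTop 1] with n h1 h2 h3
    have h4 := log_le_sq_mul_epsRate_sq (M₀ := M₀) (d := d n) (sb := sb n) (sx := sx n) h3 (hp n)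
    rw [← hε_def] at h4
    have h5 : (n : ℝ) ^ 2 * ε n ^ 2 ≤ (n : ℝ) ^ 2 * M₀ ^ 2 := by gcongr
    have h6 : (d n : ℝ) * 1 ≤ d n * Real.log n := by gcongr
    have h7 : M₀ ^ 2 * (d n * Real.log n) ≤ M₀ ^ 2 * (n : ℝ) ^ 2 := by linarith
    have h8 := le_of_mul_le_mul_left h7 hM₀2
    linarith
  have hT_small : ∀ᶠ n : ℕ in atTop, M * q * Real.exp (-βs n) * ε n ^ 2 ≤ 1 := by
    have h := hβs_sparse.const_mul (M * q)
    rw [mul_zero] at h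
    filter_upwards [h.eventually_le_const one_pos] with n hn
    refine le_trans (le_of_eq ?_) hn
    rw [Real.exp_neg]; ring
  -- Replacing `κ` by `e^(-E)` explains the `+ 2` in `m'`: one unit for `κ`, one for the prior mass
  -- near `β*`.
  have hexp_κ : ∀ᶠ n : ℕ in atTop, Real.exp (-((n : ℝ) ^ 2 * ε n ^ 2)) ≤ κ :=
    (Real.tendsto_exp_neg_atTop_nhds_zero.comp hEtop).eventually_le_const hκ
  filter_upwards [hB, hZ, hprior, hd_le, hT_small, hexp_κ, eventually_ge_atTop 2,
    hcast.eventually_ge_atTop |K₂|, hcast.eventually_ge_atTop C₁,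
    hcast.eventually_ge_atTop (max cbar 1), hEtop.eventually_ge_atTop 1,
    hEtop.eventually_ge_atTop (2 * (D - 1 + η) ^ 2),
    hlog.eventually_ge_atTop (8 * C₆ ^ 4 / (M * Real.exp (-B) * M₀ ^ 2)),
    hinv.eventually_le_const (sub_pos.2 hC₅), hinv.eventually_le_const (sub_pos.2 hR₅),
    hinv.eventually_le_const hC₆]
    with n hBn hZn hpn hdn hTn hκn hn2 hK₂n hC₁n hcn hE1 hED hlogn hinv1 hinv2 hinv3
  have hn1 : 1 ≤ n := by omega
  have hn1' : (1 : ℝ) ≤ n := by exact_mod_cast hn1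
  have hn2' : (2 : ℝ) ≤ n := by exact_mod_cast hn2
  have hp1' : (1 : ℝ) ≤ p n := by exact_mod_cast hp n
  have hd1' : (1 : ℝ) ≤ d n := by exact_mod_cast hd n
  have hn0 : (0 : ℝ) < n := by linarith
  set E := (n : ℝ) ^ 2 * ε n ^ 2 with hE
  set T := M * q * Real.exp (-βs n) * ε n ^ 2 with hT
  -- The radius `1/n²` is small enough that even the column sums, which accumulate `n` errors, move
  -- by at most `1/n`.
  have hr_le : 1 / (n : ℝ) ^ 2 ≤ 1 / n :=
    one_div_le_one_div_of_le hn0 (le_self_pow₀ hn1' (by norm_num))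
  have hsub : ∀ x : Rows n (d n), frobSq (x - Xs n) ≤ (1 / (n : ℝ) ^ 2) ^ 2 →
      x ∈ boundedRegion n (d n) C₅ R₅ C₆ := fun x hx => by
    refine mem_boundedRegion_of_frobSq_sub_le (r := 1 / (n : ℝ) ^ 2) (by positivity) (hX_sup n)
      (hX_two n) (hcenter n) (by linarith) (by linarith) ?_ hx
    refine le_trans (le_of_eq ?_) hinv3
    field_simp
  have hquad : ∀ A : Rows (p n) (d n), frobSq (covariateMap (Z n) A) ≤
      max cbar 1 * n * frobSq A := by
    have hrad : 0 < c₀ * (max 1 (sb n) : ℕ) * d n * Real.log (n * p n) := by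
      have h1 : 0 < Real.log (n * p n) := Real.log_pos
        (lt_of_lt_of_le (by linarith) (le_mul_of_one_le_right hn0.le hp1'))
      have h2 : (0 : ℝ) < (max 1 (sb n) : ℕ) := by
        exact_mod_cast lt_of_lt_of_le one_pos (le_max_left 1 (sb n))
      positivity
    refine frobSq_covariateMap_le_of_ball hrad fun A hA => (hZn A hA).trans ?_
    have := frobSq_nonneg A
    gcongr
    exact le_max_left _ _
  obtain ⟨hprob, hmass⟩ := restrictedPrior_mass_ge (k := kk) (Z n) (Bs n) (Xs n) (priorβ n) (βs n)
    (c₄ * ε n) hn2 (hp n) (hd n) hdn (le_max_of_le_right zero_le_one) hcn hquad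
    (fun j l => (hBn j l).trans (const_mul_rpow_le_pow hn1 (hp n) hK₂n))
    (fun i l => (hX_sup n i l).trans hC₁n) (hsb n) (hsx n)
    (measurableSet_boundedRegion n (d n) C₅ R₅ C₆) hsub
  have hm_le : Real.exp (-(m' * E)) ≤ (restrictedPrior (Z n) (boundedRegion n (d n) C₅ R₅ C₆)
      (priorβ n)).real ({x | frobSq (x - Xs n) ≤ (1 / (n : ℝ) ^ 2) ^ 2} ×ˢ
        {β | |β - βs n| ≤ c₄ * ε n}) := by
    refine le_trans ?_ hmass
    have h1 := exp_neg_le_pow_of_rate (d := d n) (sb := sb n) (sx := sx n) (k := kk + 5) hM₀ hn1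
      (hp n)
    rw [← hε_def] at h1
    have h2 : Real.exp (-E) * Real.exp (-E) ≤ (priorβ n).real {β | |β - βs n| ≤ c₄ * ε n} :=
      (mul_le_mul_of_nonneg_right hκn (Real.exp_pos _).le).trans hpn
    refine le_trans (le_of_eq ?_) (mul_le_mul h1 h2 (by positivity) (by positivity))
    rw [← Real.exp_add, ← Real.exp_add, hm']
    congr 1
    ring
  have hnT : Real.exp (βs n) * ((n : ℝ) ^ 2 * T) = M * q * E := by
    rw [hT, hE, Real.exp_neg]
    field_simp
  -- One factor `d` is bounded by `n²`, the other is contained in `E ≥ M₀² d log n`; the spare `log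
  -- n` absorbs the constants.
  have hdT : 8 * (d n : ℝ) ^ 2 * C₆ ^ 4 ≤ (n : ℝ) ^ 4 * T := by
    have h1 := log_le_sq_mul_epsRate_sq (M₀ := M₀) (d := d n) (sb := sb n) (sx := sx n) hn1 (hp n)
    rw [← hε_def] at h1
    have h2 : 8 * C₆ ^ 4 ≤ M * Real.exp (-B) * M₀ ^ 2 * Real.log n := by
      rwa [div_le_iff₀' (by positivity)] at hlogn
    have h3 : Real.exp (-B) ≤ Real.exp (-βs n) := Real.exp_le_exp.2 (neg_le_neg (hβB n))
    calc 8 * (d n : ℝ) ^ 2 * C₆ ^ 4 = d n * d n * (8 * C₆ ^ 4) := by ring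
      _ ≤ (n : ℝ) ^ 2 * d n * (M * Real.exp (-B) * M₀ ^ 2 * Real.log n) := by gcongr
      _ = (n : ℝ) ^ 2 * (M * 1 * Real.exp (-B) * (M₀ ^ 2 * (d n * Real.log n))) := by ring
      _ ≤ (n : ℝ) ^ 2 * (M * q * Real.exp (-βs n) * E) := by gcongr
      _ = _ := by rw [hT, hE]; ring
  have hmain := posterior_recoveryLoss_bound (k := Real.exp E) (Z n) (Xs n) (priorβ n) hα₀ hα₁ hn1
    (hβB n) (hX_two n) hR₅.le (hcenter n) hTn hdT (Real.exp_pos (-(m' * E)))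
    (Real.one_le_exp (by linarith)) hprob hsub hm_le
  -- The failure probability is exponentially small, stronger than required: `e^E ≥ E²/2 ≥ (D - 1 +
  -- η)² E` once `E ≥ 2(D - 1 + η)²`.
  have hfail : 2 / Real.exp E ≤ 2 / ((D - 1 + η) ^ 2 * (n : ℝ) ^ 2 * ε n ^ 2) := by
    have h1 : (D - 1 + η) ^ 2 * (n : ℝ) ^ 2 * ε n ^ 2 = (D - 1 + η) ^ 2 * E := by rw [hE]; ring
    have hDη : 0 < D - 1 + η := by linarith
    have h2 := Real.quadratic_le_exp_of_nonneg (show 0 ≤ E by linarith)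
    rw [h1]
    refine div_le_div_of_nonneg_left (by norm_num) (by positivity) ?_
    have h3 := mul_le_mul_of_nonneg_right hED (show 0 ≤ E by linarith)
    linarith
  refine le_trans (by linarith) (hmain.trans (measureReal_mono fun Y hY => ?_))
  refine le_trans (show _ ≤ _ from hY) (ENNReal.ofReal_le_ofReal ?_)
  have h4 : (4 : ℝ) ≤ Real.exp (2 * E) := by
    have h5 : Real.exp 2 ≤ Real.exp (2 * E) := Real.exp_le_exp.2 (by linarith)
    have h6 : (4 : ℝ) ≤ Real.exp 2 := by
      have h7 : (2 : ℝ) ≤ Real.exp 1 := by linarith only [Real.add_one_le_exp (1 : ℝ)]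
      calc (4 : ℝ) = 2 * 2 := by norm_num
        _ ≤ Real.exp 1 * Real.exp 1 := by gcongr
        _ = Real.exp 2 := by rw [← Real.exp_add]; norm_num
    linarith
  have hexp_b : (n : ℝ) ^ 2 * (c₄ * ε n) ^ 2 + 4 * n * R₅ ^ 2 * (1 / (n : ℝ) ^ 2) ^ 2 ≤ b' * E := by
    have h5 : n * (1 / (n : ℝ) ^ 2) ^ 2 ≤ E := by
      refine le_trans ?_ hE1
      rw [one_div_pow, mul_one_div, div_le_one (by positivity), ← pow_mul]
      exact le_self_pow₀ hn1' (by norm_num)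
    have h6 : 4 * R₅ ^ 2 * (n * (1 / (n : ℝ) ^ 2) ^ 2) ≤ 4 * R₅ ^ 2 * E := by gcongr
    calc _ = c₄ ^ 2 * E + 4 * R₅ ^ 2 * (n * (1 / (n : ℝ) ^ 2) ^ 2) := by rw [hE]; ring
      _ ≤ _ := by rw [hb']; linarith
  -- The 4 is 2 for `4 ≤ e^(2E)` plus 2 for `k² = e^(2E)`. The bound follows from `D + 3η ≥ 1 + η`.
  have hcoef : η + b' + m' + 4 ≤ c * (M * q) := by
    have h5 : c * M * (D + 3 * η) ≤ c * M * q := by gcongr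
    have h6 : (b' + m' + 5) * (1 + η) ≤ c * M * (D + 3 * η) :=
      mul_le_mul hcM (by linarith) (by positivity) (by positivity)
    have h7 : η ≤ (b' + m' + 5) * η := le_mul_of_one_le_left hη.le (by linarith)
    linarith
  rw [hnT]
  calc 4 * Real.exp (-(c * (M * q * E))) *
        Real.exp ((n : ℝ) ^ 2 * (c₄ * ε n) ^ 2 + 4 * n * R₅ ^ 2 * (1 / (n : ℝ) ^ 2) ^ 2) *
        Real.exp E ^ 2 / Real.exp (-(m' * E))
      ≤ Real.exp (2 * E) * Real.exp (-(c * (M * q * E))) * Real.exp (b' * E) *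
        Real.exp E ^ 2 / Real.exp (-(m' * E)) := by gcongr
    _ = Real.exp (2 * E + -(c * (M * q * E)) + b' * E + 2 * E - -(m' * E)) := by
        rw [Real.exp_sub, Real.exp_add, Real.exp_add, Real.exp_add, ← Real.exp_nat_mul]
        norm_num
    _ ≤ Real.exp (-(η * (n : ℝ) ^ 2 * ε n ^ 2)) := by
        refine Real.exp_le_exp.2 ?_
        have h5 : η * (n : ℝ) ^ 2 * ε n ^ 2 = η * E := by rw [hE]; ring
        have h6 := mul_le_mul_of_nonneg_right hcoef (show 0 ≤ E by linarith)
        rw [h5]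
        linarith
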